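/- Let $\Bbbk$ be a field, let $n\ge 1$, let $\det_n$ and $\operatorname{perm}_n$ be the determinant and the permanent of the $n\times n$ matrix of indeterminates $(x_{i,j})$, and let $S=\Bbbk[X_{i,j} : 1\le i,j\le n]$ act on $R=\Bbbk[x_{i,j}]$ by contraction: $\star$ is $\Bbbk$-bilinear, and $X^a\star x^b=x^{b-a}$ if $a\le b$ entrywise and $X^a\star x^b=0$ otherwise. For $f\in R$ let $f^\perp=\{g\in S : g\star f=0\}$ be its apolar ideal. For $\varepsilon\in\{1,-1\}$ let $G_\varepsilon$ be the family of $\binom{n+1}{2}^2$ quadrics indexed by the pairs $i\le i'$, $j\le j'$ in $\{1,\dots,n\}$, whose member at $(i,i',j,j')$ is $$X_{i,j}X_{i',j'}+\varepsilon X_{i,j'}X_{i',j}\ \text{ if } i<i' \text{ and } j<j', \qquad X_{i,j}X_{i',j'}\ \text{ if } i=i' \text{ or } j=j'.$$ By a theorem of Shafiei, $G_1$ is a minimal generating set of $\det_n^\perp$ and $G_{-1}$ is a minimal generating set of $\operatorname{perm}_n^\perp$. A relation is a tuple $(c_g)_{g}$ of elements of $S$, indexed by the members $g$ of the family, with $\sum_g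 c_g\,g=0$; it is linear (respectively quadratic) if every $c_g$ is homogeneous of degree $1$ (respectively $2$). A family minimally generates a module if it generates it and no proper subfamily does. (a) If $\operatorname{char}\Bbbk\ne 2$, then $G_1$ minimally generates $\det_n^\perp$, and the $S$-module of relations of $G_1$ is minimally generated by $4\binom{n+1}{3}\binom{n+2}{3}$ linear relations. (b) In any characteristic, $G_{-1}$ minimally generates $\operatorname{perm}_n^\perp$, and the $S$-module of relations of $G_{-1}$ is minimally generated by $4\binom{n+1}{3}\binom{n+2}{3}$ linear relations together with $2\binom n2\binom n4$ quadratic relations. -/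

import Mathlib

noncomputable section

/-- The contraction action `g ⋆ f` of `S = k[X_i]` on `R = k[x_i]` (differentiation without
coefficients): it is bilinear over `k`, and the monomial `X^a` sends `x^b` to `x^(b - a)` if
`a ≤ b` and to `0` otherwise. Both polynomial rings are `MvPolynomial σ k`. -/
def contract {σ k : Type*} [Field k] (g f : MvPolynomial σ k) : MvPolynomial σ k :=
  ∑ a ∈ g.support, g.coeff a • f.divMonomial a

theorem contract_eq_sum {σ k : Type*} [Field k] (g f : MvPolynomial σ k)
    (s : Finset (σ →₀ ℕ)) (hs : g.support ⊆ s) :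
    contract g f = ∑ a ∈ s, g.coeff a • f.divMonomial a := by
  refine Finset.sum_subset hs fun a _ ha => ?_
  rw [MvPolynomial.notMem_support_iff.mp ha, zero_smul]

theorem contract_add_left {σ k : Type*} [Field k] (g h f : MvPolynomial σ k) :
    contract (g + h) f = contract g f + contract h f := by
  classical
  rw [contract_eq_sum (g + h) f (g.support ∪ h.support) MvPolynomial.support_add,
    contract_eq_sum g f (g.support ∪ h.support) Finset.subset_union_left,
    contract_eq_sum h f (g.support ∪ h.support) Finset.subset_union_right,
    ← Finset.sum_add_distrib]
  simp only [MvPolynomial.coeff_add, add_smul]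

theorem contract_monomial {σ k : Type*} [Field k] (a : σ →₀ ℕ) (c : k)
    (f : MvPolynomial σ k) :
    contract (MvPolynomial.monomial a c) f = c • f.divMonomial a := by
  classical
  rw [contract_eq_sum _ f {a} MvPolynomial.support_monomial_subset]
  simp

theorem contract_zero_right {σ k : Type*} [Field k] (g : MvPolynomial σ k) :
    contract g 0 = 0 := by
  simp [contract]

theorem contract_monomial_mul {σ k : Type*} [Field k] (a : σ →₀ ℕ) (c : k)
    (g f : MvPolynomial σ k) :
    contract (MvPolynomial.monomial a c * g) f
      = contract (MvPolynomial.monomial a c) (contract g f) := by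
  have hadd : ∀ p q : MvPolynomial σ k,
      contract (MvPolynomial.monomial a c) (p + q)
        = contract (MvPolynomial.monomial a c) p + contract (MvPolynomial.monomial a c) q := by
    intro p q
    simp only [contract_monomial, MvPolynomial.add_divMonomial, smul_add]
  induction g using MvPolynomial.induction_on' with
  | monomial b d =>
    rw [MvPolynomial.monomial_mul]
    simp only [contract_monomial]
    ext e
    simp only [MvPolynomial.coeff_smul, MvPolynomial.coeff_divMonomial, smul_eq_mul]
    rw [mul_assoc, add_assoc, add_left_comm]
  | add p q hp hq => rw [mul_add, contract_add_left, hp, hq, contract_add_left, hadd]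

/-- The apolar ideal `f^⊥ = {g ∈ S | g ⋆ f = 0}`. -/
def apolarIdeal {σ k : Type*} [Field k] (f : MvPolynomial σ k) : Ideal (MvPolynomial σ k) where
  carrier := {g | contract g f = 0}
  zero_mem' := by simp [contract]
  add_mem' := by
    intro g h hg hh
    simp only [Set.mem_ofPred_eq] at hg hh ⊢
    rw [contract_add_left, hg, hh, add_zero]
  smul_mem' := by
    intro h g hg
    simp only [Set.mem_ofPred_eq, smul_eq_mul] at hg ⊢
    induction h using MvPolynomial.induction_on' with
    | monomial a c => rw [contract_monomial_mul, hg, contract_zero_right]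
    | add p q hp hq => rw [add_mul, contract_add_left, hp, hq, add_zero]

/-- The determinant of the `n × n` matrix of indeterminates. -/
def detPoly (k : Type*) [Field k] (n : ℕ) : MvPolynomial (Fin n × Fin n) k :=
  (Matrix.mvPolynomialX (Fin n) (Fin n) k).det

/-- The permanent of the `n × n` matrix of indeterminates. -/
def permPoly (k : Type*) [Field k] (n : ℕ) : MvPolynomial (Fin n × Fin n) k :=
  (Matrix.mvPolynomialX (Fin n) (Fin n) k).permanent

/-- The index set of Shafiei's generators: pairs `(i ≤ i', j ≤ j')` of weakly increasing pairs of
row indices and of column indices. -/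
abbrev QuadricIndex (n : ℕ) : Type :=
  {r : Fin n × Fin n // r.1 ≤ r.2} × {c : Fin n × Fin n // c.1 ≤ c.2}

/-- Shafiei's generators, listed without repetition. For `i < i'` and `j < j'` the generator is
`X_{i,j} X_{i',j'} + ε X_{i,j'} X_{i',j}`; in the other cases it is the monomial
`X_{i,j} X_{i',j'}`, i.e. `X_{i,j}²`, `X_{i,j} X_{i,j'}` or `X_{i,j} X_{i',j}`. -/
def shafieiQuadric {k : Type*} [Field k] {n : ℕ} (ε : k) (p : QuadricIndex n) :
    MvPolynomial (Fin n × Fin n) k :=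
  let i := p.1.1.1
  let i' := p.1.1.2
  let j := p.2.1.1
  let j' := p.2.1.2
  if i < i' ∧ j < j' then
    MvPolynomial.X (i, j) * MvPolynomial.X (i', j')
      + ε • (MvPolynomial.X (i, j') * MvPolynomial.X (i', j))
  else MvPolynomial.X (i, j) * MvPolynomial.X (i', j')

/-- Shafiei's generators of the apolar ideal of the determinant. -/
def detQuadric (k : Type*) [Field k] (n : ℕ) :
    QuadricIndex n → MvPolynomial (Fin n × Fin n) k :=
  shafieiQuadric 1

/-- Shafiei's generators of the apolar ideal of the permanent. -/
def permQuadric (k : Type*) [Field k] (n : ℕ) :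
    QuadricIndex n → MvPolynomial (Fin n × Fin n) k :=
  shafieiQuadric (-1)

/-- The module of relations (first syzygies) of a finite family `g` of elements of a commutative
ring `S`: all families of coefficients `c` with `∑ p, c p * g p = 0`. -/
def relationModule {S ι : Type*} [CommRing S] [Fintype ι] (g : ι → S) : Submodule S (ι → S) :=
  LinearMap.ker (Fintype.linearCombination S g)

/-- An element of the free module on `ι` is homogeneous of coefficient degree `d` if all its
coefficients are homogeneous polynomials of degree `d`. A relation is linear for `d = 1` and
quadratic for `d = 2`. -/
def HasCoeffDegree {σ k ι : Type*} [Field k] (d : ℕ) (c : ι → MvPolynomial σ k) : Prop :=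
  ∀ p, (c p).IsHomogeneous d

/-- The family `r` generates the submodule `N`, and no proper subfamily of `r` does. -/
def IsMinimalGeneratingFamily {S F ι : Type*} [CommRing S] [AddCommGroup F] [Module S F]
    (N : Submodule S F) (r : ι → F) : Prop :=
  Submodule.span S (Set.range r) = N ∧
    ∀ s : Set ι, Submodule.span S (r '' s) = N → s = Set.univ

end

/-! Both families are treated at once, with a sign `ε` satisfying `ε * ε = 1`. Give `X_{i,j}` the
weight `i * j`. If `i < i'` and `j < j'`, the diagonal product outweighs the antidiagonal one, so
the leading monomials of the quadrics are exactly the products `X_u X_v` with `u ≤ v` entrywise. A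
standard monomial, divisible by none of them, is a squarefree product over cells running strictly
from top right to bottom left; it is determined by its row set and its column set. Contraction
against the determinant or the permanent shows that standard monomials are linearly independent
modulo the apolar ideal (`eq_zero_of_mem_apolarIdeal`). Hence the quadrics behave like a Gröbner
basis, and they generate the ideal (`IsQuadraticBasis.span_range`).

Relations come from S-pairs (`IsQuadraticBasis.relationModule_le`). If two leading monomials share a
variable, the S-pair reduces by a linear relation. If a variable of one is comparable with a
variable of the other, a third quadric bridges the two. Otherwise the two quadrics have disjoint
rows and disjoint columns, and their Koszul relation is needed. It follows from linear relations
(`shafieiQuadric_smul_single_mem`), except when both quadrics are monomials supported on one row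
each (or one column each), with four distinct columns (rows). Modulo linear relations, exchanging
two of these columns between the two rows multiplies the exceptional relation by `-ε`. For `ε = 1`
this clashes with the symmetry within a row and gives twice the relation equal to zero, so it
disappears when 2 is invertible. For `ε = -1` the relation is invariant under all permutations of
the columns, so one is left for each pair of rows and each set of four columns, and likewise for
columns.

The number of linear relations is a dimension count in degree 3: by the standard monomials, tuples
of linear forms map onto a complement of a space of dimension `(n choose 3)^2` in the cubics.
Minimality is a degree argument, except that the quadratic relations of the permanent must be
separated from multiples of linear ones. This is done by the functional `relForm`: it maps linear
relations into the ideal of squares by a substitution of a rank-one matrix, on which all 2 × 2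
minors vanish (`relForm_mem_squareIdeal`), but maps the quadratic relations to zero or to squarefree
monomials. -/

open MvPolynomial

set_option linter.unusedSectionVars false

noncomputable section

/-! ### Division and the S-pair criterion for quadrics with weighted leading monomials. -/

section WeightedBasis

variable {σ ι k : Type*} [Field k] [Fintype ι] [DecidableEq ι]

/-- A monomial exponent is standard if no leading exponent divides it. -/
def IsStandard (lead : ι → σ →₀ ℕ) (m : σ →₀ ℕ) : Prop := ∀ p, ¬ lead p ≤ m

/-- The span of the monomials with degree in `D` and weight less than `W`. -/
def monosBelow (k : Type*) [Field k] (w : σ → ℕ) (D : Set ℕ) (W : ℕ) :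
    Submodule k (MvPolynomial σ k) :=
  Submodule.span k {f | ∃ m : σ →₀ ℕ, m.degree ∈ D ∧ Finsupp.weight w m < W ∧ f = monomial m 1}

/-- The span of the standard monomials with degree in `D`. -/
def standardSpan (k : Type*) [Field k] (lead : ι → σ →₀ ℕ) (D : Set ℕ) :
    Submodule k (MvPolynomial σ k) :=
  Submodule.span k {f | ∃ m : σ →₀ ℕ, IsStandard lead m ∧ m.degree ∈ D ∧ f = monomial m 1}

/-- The span of the elements `X^m • e_p` with `deg m ∈ D` for which the weight of
`X^m * lead p` is less than `W`. -/
def relsBelow (k : Type*) [Field k] (w : σ → ℕ) (lead : ι → σ →₀ ℕ) (D : Set ℕ) (W : ℕ) :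
    Submodule k (ι → MvPolynomial σ k) :=
  Submodule.span k {c | ∃ (m : σ →₀ ℕ) (p : ι), m.degree ∈ D ∧
    Finsupp.weight w (m + lead p) < W ∧ c = Pi.single p (monomial m 1)}

/-- The evaluation `(c_p) ↦ ∑ c_p g_p`, as a `k`-linear map. -/
def evalRel (g : ι → MvPolynomial σ k) : (ι → MvPolynomial σ k) →ₗ[k] MvPolynomial σ k :=
  (Fintype.linearCombination (MvPolynomial σ k) g).restrictScalars k

/-- A family of polynomials in an ideal `I` whose members are a quadratic monomial plus terms of
smaller weight, such that the standard monomials are linearly independent modulo `I`. -/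
structure IsQuadraticBasis (w : σ → ℕ) (lead : ι → σ →₀ ℕ) (g : ι → MvPolynomial σ k)
    (I : Ideal (MvPolynomial σ k)) : Prop where
  degree_lead : ∀ p, (lead p).degree = 2
  tail_mem : ∀ p, g p - monomial (lead p) 1 ∈ monosBelow k w {2} (Finsupp.weight w (lead p))
  mem : ∀ p, g p ∈ I
  eq_zero : ∀ f ∈ I, f ∈ standardSpan k lead Set.univ → f = 0

theorem evalRel_apply (g : ι → MvPolynomial σ k) (c : ι → MvPolynomial σ k) :
    evalRel g c = ∑ p, c p * g p := by
  simp [evalRel, Fintype.linearCombination_apply]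

theorem evalRel_smul (g : ι → MvPolynomial σ k) (f : MvPolynomial σ k)
    (c : ι → MvPolynomial σ k) : evalRel g (f • c) = f * evalRel g c := by
  simp [evalRel]

theorem evalRel_single (g : ι → MvPolynomial σ k) (p : ι) (f : MvPolynomial σ k) :
    evalRel g (Pi.single p f) = f * g p := by
  rw [evalRel_apply, Finset.sum_eq_single p]
  · simp
  · intro q _ hq; simp [hq]
  · simp

theorem monosBelow_mono (w : σ → ℕ) {D D' : Set ℕ} (hD : D ⊆ D') {W W' : ℕ} (hW : W ≤ W') :
    monosBelow k w D W ≤ monosBelow k w D' W' := by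
  refine Submodule.span_mono ?_
  rintro _ ⟨m, h1, h2, rfl⟩
  exact ⟨m, hD h1, h2.trans_le hW, rfl⟩

theorem relsBelow_mono (w : σ → ℕ) (lead : ι → σ →₀ ℕ) {D D' : Set ℕ} (hD : D ⊆ D') {W W' : ℕ}
    (hW : W ≤ W') : relsBelow k w lead D W ≤ relsBelow k w lead D' W' := by
  refine Submodule.span_mono ?_
  rintro _ ⟨m, p, h1, h2, rfl⟩
  exact ⟨m, p, hD h1, h2.trans_le hW, rfl⟩

theorem standardSpan_mono (lead : ι → σ →₀ ℕ) {D D' : Set ℕ} (hD : D ⊆ D') :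
    standardSpan k lead D ≤ standardSpan k lead D' := by
  refine Submodule.span_mono ?_
  rintro _ ⟨m, h0, h1, rfl⟩
  exact ⟨m, h0, hD h1, rfl⟩

theorem monomial_mul_mem_monosBelow {w : σ → ℕ} {d W : ℕ} (m : σ →₀ ℕ)
    {f : MvPolynomial σ k} (hf : f ∈ monosBelow k w {d} W) :
    monomial m 1 * f ∈ monosBelow k w {m.degree + d} (Finsupp.weight w m + W) := by
  induction hf using Submodule.span_induction with
  | mem x hx =>
    obtain ⟨m', h1, h2, rfl⟩ := hx
    refine Submodule.subset_span ⟨m + m', ?_, ?_, ?_⟩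
    · rw [Set.mem_singleton_iff] at h1 ⊢; rw [map_add, h1]
    · rw [map_add]; omega
    · rw [monomial_mul, one_mul]
  | zero => simp
  | add x y _ _ hx hy => rw [mul_add]; exact add_mem hx hy
  | smul a x _ hx => rw [mul_smul_comm]; exact Submodule.smul_mem _ _ hx

theorem monomial_smul_mem_relsBelow {w : σ → ℕ} {lead : ι → σ →₀ ℕ} {D : Set ℕ} {W : ℕ}
    (m : σ →₀ ℕ) {c : ι → MvPolynomial σ k} (hc : c ∈ relsBelow k w lead D W) :
    (monomial m 1 : MvPolynomial σ k) • c
      ∈ relsBelow k w lead Set.univ (Finsupp.weight w m + W) := by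
  induction hc using Submodule.span_induction with
  | mem x hx =>
    obtain ⟨m', p, h1, h2, rfl⟩ := hx
    refine Submodule.subset_span ⟨m + m', p, trivial, ?_, ?_⟩
    · rw [add_assoc, map_add]; omega
    · rw [← Pi.single_smul, smul_eq_mul, monomial_mul, one_mul]
  | zero => simp
  | add x y _ _ hx hy => rw [smul_add]; exact add_mem hx hy
  | smul a x _ hx => rw [smul_comm]; exact Submodule.smul_mem _ _ hx

theorem coeff_eq_zero_of_mem_monosBelow {w : σ → ℕ} {D : Set ℕ} {W : ℕ} {f : MvPolynomial σ k}
    (hf : f ∈ monosBelow k w D W) {z : σ →₀ ℕ} (hz : W ≤ Finsupp.weight w z) : coeff z f = 0 := by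
  classical
  induction hf using Submodule.span_induction with
  | mem x hx =>
    obtain ⟨m', h1, h2, rfl⟩ := hx
    rw [coeff_monomial, if_neg]
    rintro rfl
    omega
  | zero => simp
  | add x y _ _ hx hy => rw [coeff_add, hx, hy, add_zero]
  | smul a x _ hx => rw [coeff_smul, hx, smul_zero]

theorem mem_monosBelow_of_coeff {w : σ → ℕ} {D : Set ℕ} {W : ℕ} {f : MvPolynomial σ k}
    (hf : ∀ m ∈ f.support, m.degree ∈ D ∧ Finsupp.weight w m < W) : f ∈ monosBelow k w D W := by
  rw [f.as_sum]
  refine Submodule.sum_mem _ fun m hm => ?_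
  rw [← mul_one (coeff m f), ← smul_eq_mul, ← smul_monomial]
  exact Submodule.smul_mem _ _ (Submodule.subset_span ⟨m, (hf m hm).1, (hf m hm).2, rfl⟩)

theorem exists_mem_monosBelow (w : σ → ℕ) (f : MvPolynomial σ k) :
    ∃ W, f ∈ monosBelow k w Set.univ W :=
  ⟨f.support.sup (Finsupp.weight w) + 1, mem_monosBelow_of_coeff fun _ hm =>
    ⟨trivial, Nat.lt_succ_of_le (Finset.le_sup (f := Finsupp.weight w) hm)⟩⟩

theorem exists_mem_relsBelow (w : σ → ℕ) (lead : ι → σ →₀ ℕ) (c : ι → MvPolynomial σ k) :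
    ∃ W, c ∈ relsBelow k w lead Set.univ W := by
  suffices hc : ∀ p, (Pi.single p (c p) : ι → MvPolynomial σ k) ∈ relsBelow k w lead Set.univ
      (Finset.univ.sup (fun p => (c p).support.sup fun m => Finsupp.weight w (m + lead p)) + 1) by
    have := Submodule.sum_mem _ fun p (_ : p ∈ Finset.univ) => hc p
    rw [Finset.univ_sum_single c] at this
    exact ⟨_, this⟩
  intro p
  rw [(c p).as_sum, show Pi.single p (∑ m ∈ (c p).support, monomial m (coeff m (c p)))
    = LinearMap.single k (fun _ : ι => MvPolynomial σ k) p
      (∑ m ∈ (c p).support, monomial m (coeff m (c p))) from rfl, map_sum]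
  refine Submodule.sum_mem _ fun m hm => ?_
  rw [← mul_one (coeff m (c p)), ← smul_eq_mul, ← smul_monomial, map_smul]
  refine Submodule.smul_mem _ _ (Submodule.subset_span ⟨m, p, trivial, ?_, rfl⟩)
  exact Nat.lt_succ_of_le (le_trans
    (Finset.le_sup (f := fun m => Finsupp.weight w (m + lead p)) hm)
    (Finset.le_sup (f := fun p => (c p).support.sup fun m => Finsupp.weight w (m + lead p))
      (Finset.mem_univ p)))

namespace IsQuadraticBasis

variable {w : σ → ℕ} {lead : ι → σ →₀ ℕ} {g : ι → MvPolynomial σ k}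
  {I : Ideal (MvPolynomial σ k)}

theorem monomial_mul_sub_mem (h : IsQuadraticBasis w lead g I) (m : σ →₀ ℕ) (p : ι) :
    monomial m 1 * g p - monomial (m + lead p) 1
      ∈ monosBelow k w {(m + lead p).degree} (Finsupp.weight w (m + lead p)) := by
  have := monomial_mul_mem_monosBelow m (h.tail_mem p)
  rwa [mul_sub, monomial_mul, one_mul, ← h.degree_lead p, ← map_add, ← map_add] at this

theorem evalRel_mem (h : IsQuadraticBasis w lead g I) (c : ι → MvPolynomial σ k) :
    evalRel g c ∈ I := by
  rw [evalRel_apply]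
  exact Ideal.sum_mem _ fun p _ => I.mul_mem_left _ (h.mem p)

/-- Division with remainder. The weight need not come from a monomial order: replacing a leading
monomial by its tail strictly lowers a natural number, so induction on the weight bound terminates.
-/
theorem monosBelow_le (h : IsQuadraticBasis w lead g I) (D : Set ℕ) (W : ℕ) :
    monosBelow k w D W ≤
      (relsBelow k w lead {e | e + 2 ∈ D} W).map (evalRel g) ⊔ standardSpan k lead D := by
  induction W with
  | zero =>
    refine Submodule.span_le.2 ?_
    rintro _ ⟨m, _, h2, rfl⟩
    omega
  | succ W ih =>
    refine Submodule.span_le.2 ?_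
    rintro _ ⟨m, hm, hW, rfl⟩
    by_cases hs : IsStandard lead m
    · exact Submodule.mem_sup_right (Submodule.subset_span ⟨m, hs, hm, rfl⟩)
    · simp only [IsStandard, not_forall, not_not] at hs
      obtain ⟨p, hp⟩ := hs
      obtain ⟨m', rfl⟩ := exists_add_of_le hp
      rw [add_comm (lead p) m'] at hm hW ⊢
      rw [← sub_sub_cancel (monomial m' 1 * g p) (monomial (m' + lead p) (1 : k))]
      refine sub_mem (Submodule.mem_sup_left ?_) ?_
      · rw [← evalRel_single]
        refine Submodule.mem_map_of_mem (Submodule.subset_span ⟨m', p, ?_, hW, rfl⟩)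
        rwa [map_add, h.degree_lead] at hm
      · have h1 : monomial m' 1 * g p - monomial (m' + lead p) 1 ∈ monosBelow k w D W :=
          monosBelow_mono w (Set.singleton_subset_iff.2 hm) (Nat.le_of_lt_succ hW)
            (h.monomial_mul_sub_mem m' p)
        have h2 := Submodule.map_mono (f := evalRel g)
          (relsBelow_mono (k := k) w lead (subset_refl {e | e + 2 ∈ D}) (Nat.le_succ W))
        exact (sup_le_sup h2 le_rfl : _ ≤ _ ⊔ standardSpan k lead D) (ih h1)

/-- The remainder of a member of `I` is standard and lies in `I`, hence vanishes. The point is that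
the representation respects both the degree and the weight bound. -/
theorem exists_relsBelow (h : IsQuadraticBasis w lead g I) {D : Set ℕ} {W : ℕ}
    {f : MvPolynomial σ k} (hf : f ∈ monosBelow k w D W) (hfI : f ∈ I) :
    ∃ c ∈ relsBelow k w lead {e | e + 2 ∈ D} W, evalRel g c = f := by
  obtain ⟨_, ⟨c, hc, rfl⟩, s, hs, rfl⟩ := Submodule.mem_sup.1 (h.monosBelow_le D W hf)
  refine ⟨c, hc, ?_⟩
  have : s ∈ I := (Submodule.add_mem_iff_right I (h.evalRel_mem c)).1 hfI
  rw [h.eq_zero s this (standardSpan_mono lead (Set.subset_univ _) hs), add_zero]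

theorem span_range (h : IsQuadraticBasis w lead g I) : Submodule.span _ (Set.range g) = I := by
  refine le_antisymm (Submodule.span_le.2 ?_) fun f hf => ?_
  · rintro _ ⟨p, rfl⟩
    exact h.mem p
  · obtain ⟨W, hW⟩ := exists_mem_monosBelow w f
    obtain ⟨c, -, rfl⟩ := h.exists_relsBelow hW hf
    rw [evalRel_apply]
    exact Submodule.sum_mem _ fun p _ => Submodule.smul_mem _ _ (Submodule.subset_span ⟨p, rfl⟩)

theorem evalRel_mem_monosBelow (h : IsQuadraticBasis w lead g I) {D : Set ℕ} {W : ℕ}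
    {c : ι → MvPolynomial σ k} (hc : c ∈ relsBelow k w lead D W) :
    evalRel g c ∈ monosBelow k w Set.univ W := by
  induction hc using Submodule.span_induction with
  | mem x hx =>
    obtain ⟨m, p, -, h2, rfl⟩ := hx
    rw [evalRel_single, ← sub_add_cancel (monomial m 1 * g p) (monomial (m + lead p) (1 : k))]
    exact add_mem (monosBelow_mono w (Set.subset_univ _) h2.le (h.monomial_mul_sub_mem m p))
      (Submodule.subset_span ⟨_, trivial, h2, rfl⟩)
  | zero => simp
  | add x y _ _ hx hy => rw [map_add]; exact add_mem hx hy
  | smul a x _ hx => rw [map_smul]; exact Submodule.smul_mem _ _ hx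

theorem hasCoeffDegree_of_mem_relsBelow {d W : ℕ} {c : ι → MvPolynomial σ k}
    (hc : c ∈ relsBelow k w lead {d} W) : HasCoeffDegree d c := by
  intro q
  induction hc using Submodule.span_induction with
  | mem x hx =>
    obtain ⟨m, p, h1, -, rfl⟩ := hx
    rw [Pi.single_apply]
    split_ifs
    · exact isHomogeneous_monomial _ h1
    · exact isHomogeneous_zero _ _ _
  | zero => exact isHomogeneous_zero _ _ _
  | add x y _ _ hx hy => exact hx.add hy
  | smul a x _ hx => exact (homogeneousSubmodule σ k d).smul_mem a hx

/-- The reduction of the S-pair of two members whose leading monomials have a linear quotient. -/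
theorem single_sub_single_mem (h : IsQuadraticBasis w lead g I)
    {N : Submodule (MvPolynomial σ k) (ι → MvPolynomial σ k)}
    (hN : ∀ c, HasCoeffDegree 1 c → evalRel g c = 0 → c ∈ N)
    {p q : ι} {m m' : σ →₀ ℕ} (hm : m.degree = 1) (hm' : m'.degree = 1)
    (hpq : m + lead p = m' + lead q) :
    (Pi.single p (monomial m 1) - Pi.single q (monomial m' 1) : ι → MvPolynomial σ k)
      ∈ N.restrictScalars k ⊔ relsBelow k w lead Set.univ (Finsupp.weight w (m + lead p)) := by
  set r : ι → MvPolynomial σ k := Pi.single p (monomial m 1) - Pi.single q (monomial m' 1) with hr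
  have h3 : (m + lead p).degree = 3 := by rw [map_add, hm, h.degree_lead]
  have h1 : evalRel g r ∈ monosBelow k w {3} (Finsupp.weight w (m + lead p)) := by
    have e1 := h.monomial_mul_sub_mem m p
    have e2 := h.monomial_mul_sub_mem m' q
    rw [← hpq] at e2
    have := sub_mem e1 e2
    rw [sub_sub_sub_cancel_right, h3] at this
    rwa [hr, map_sub, evalRel_single, evalRel_single]
  -- The leading terms cancel, so the value of `r` has a representation `c` of lower weight; `r - c`
  -- is then an exact linear relation.
  obtain ⟨c, hc, hcr⟩ := h.exists_relsBelow h1 (h.evalRel_mem r)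
  have hc1 : c ∈ relsBelow k w lead {1} (Finsupp.weight w (m + lead p)) := by
    refine relsBelow_mono w lead ?_ le_rfl hc
    intro e he
    simp only [Set.mem_ofPred_eq, Set.mem_singleton_iff] at he ⊢
    omega
  rw [← sub_add_cancel r c]
  refine Submodule.add_mem_sup (hN _ ?_ ?_) (relsBelow_mono w lead (Set.subset_univ _) le_rfl hc1)
  · intro x
    have e1 : HasCoeffDegree 1 r := by
      intro x
      simp only [hr, Pi.sub_apply, Pi.single_apply]
      refine IsHomogeneous.sub ?_ ?_ <;> split_ifs
      · exact isHomogeneous_monomial _ hm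
      · exact isHomogeneous_zero _ _ _
      · exact isHomogeneous_monomial _ hm'
      · exact isHomogeneous_zero _ _ _
    exact (e1 x).sub (hasCoeffDegree_of_mem_relsBelow hc1 x)
  · rw [map_sub, hcr, sub_self]

/-- If all S-pairs reduce to lower terms modulo a module `N` of relations, then `N` is the module
of all relations. -/
theorem relationModule_le (h : IsQuadraticBasis w lead g I)
    {N : Submodule (MvPolynomial σ k) (ι → MvPolynomial σ k)} (hN : N ≤ relationModule g)
    (H : ∀ (p q : ι) (m m' : σ →₀ ℕ), m + lead p = m' + lead q →
      (Pi.single p (monomial m 1) - Pi.single q (monomial m' 1) : ι → MvPolynomial σ k)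
      ∈ N.restrictScalars k ⊔ relsBelow k w lead Set.univ (Finsupp.weight w (m + lead p))) :
    relationModule g ≤ N := by
  classical
  suffices hW : ∀ W, ∀ r ∈ relsBelow k w lead Set.univ W, evalRel g r = 0 → r ∈ N by
    intro r hr
    obtain ⟨W, hr'⟩ := exists_mem_relsBelow w lead r
    exact hW W r hr' hr
  intro W
  induction W with
  | zero =>
    intro r hr _
    have : relsBelow k w lead Set.univ 0 ≤ ⊥ := by
      refine Submodule.span_le.2 ?_
      rintro _ ⟨m, p, _, h2, rfl⟩
      omega
    rw [(Submodule.mem_bot k).1 (this hr)]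
    exact N.zero_mem
  | succ W ih =>
    intro r hr hr0
    -- Fix one element `X^m e_p` with leading monomial `z` for each nonstandard `z`. By `H`, any
    -- other element with the same leading monomial agrees with it modulo `N` and lower weight.
    have hex : ∀ z : σ →₀ ℕ, ∃ s : ι → MvPolynomial σ k, ¬ IsStandard lead z →
        ∃ m p, z = m + lead p ∧ s = Pi.single p (monomial m 1) := by
      intro z
      by_cases hz : IsStandard lead z
      · exact ⟨0, fun h => (h hz).elim⟩
      · have hz' := hz
        simp only [IsStandard, not_forall, not_not] at hz'
        obtain ⟨p, hp⟩ := hz'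
        obtain ⟨m, rfl⟩ := exists_add_of_le hp
        exact ⟨_, fun _ => ⟨m, p, add_comm _ _, rfl⟩⟩
    choose s hs using hex
    set Z : Set (σ →₀ ℕ) := {z | ¬ IsStandard lead z ∧ Finsupp.weight w z = W}
    have hle : relsBelow k w lead Set.univ (W + 1) ≤
        (N.restrictScalars k ⊔ relsBelow k w lead Set.univ W) ⊔ Submodule.span k (s '' Z) := by
      refine Submodule.span_le.2 ?_
      rintro _ ⟨m, p, -, h2, rfl⟩
      rcases Nat.lt_succ_iff_lt_or_eq.1 h2 with h2 | h2
      · exact Submodule.mem_sup_left (Submodule.mem_sup_right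
          (Submodule.subset_span ⟨m, p, trivial, h2, rfl⟩))
      · have hz : ¬ IsStandard lead (m + lead p) := fun hst => hst p le_add_self
        obtain ⟨m', q, e1, e2⟩ := hs _ hz
        rw [← sub_add_cancel (Pi.single p (monomial m 1) : ι → MvPolynomial σ k) (s (m + lead p))]
        refine Submodule.add_mem_sup ?_ (Submodule.subset_span ⟨_, ⟨hz, h2⟩, rfl⟩)
        rw [e2, ← h2]
        exact H _ _ _ _ e1
    obtain ⟨y, hy, x, hx, rfl⟩ := Submodule.mem_sup.1 (hle hr)
    obtain ⟨y1, hy1, y2, hy2, rfl⟩ := Submodule.mem_sup.1 hy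
    obtain ⟨a, ha, rfl⟩ := (Finsupp.mem_span_image_iff_linearCombination k).1 hx
    have hy1' : evalRel g y1 = 0 := hN hy1
    -- Compare coefficients at `z` of weight `W`: the part of lower weight contributes nothing, and
    -- among the chosen representatives only that of `z` contains this monomial. So no
    -- representative occurs, and what remains has lower weight.
    have ha0 : a = 0 := by
      ext z
      by_cases hz : z ∈ Z
      swap
      · exact (Finsupp.mem_supported' k a).1 ha z hz
      have e0 := congrArg (coeff z) hr0
      rw [map_add, map_add, hy1', zero_add, coeff_add, coeff_zero,
        coeff_eq_zero_of_mem_monosBelow (h.evalRel_mem_monosBelow hy2) hz.2.ge, zero_add,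
        Finsupp.linearCombination_apply, Finsupp.sum, map_sum, coeff_sum] at e0
      rw [Finset.sum_eq_single z] at e0
      · obtain ⟨m, p, e1, e2⟩ := hs z hz.1
        have := coeff_eq_zero_of_mem_monosBelow (h.monomial_mul_sub_mem m p) le_rfl
        rw [coeff_sub, coeff_monomial, if_pos rfl, sub_eq_zero, ← e1] at this
        simpa [e2, evalRel_single, this] using e0
      · intro y hy hyz
        obtain ⟨hyZ, hyW⟩ : y ∈ Z := (Finsupp.mem_supported k a).1 ha hy
        obtain ⟨m, p, e1, e2⟩ := hs y hyZ
        have := coeff_eq_zero_of_mem_monosBelow (h.monomial_mul_sub_mem m p)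
          (z := z) (by rw [← e1, hyW, hz.2])
        rw [coeff_sub, coeff_monomial, if_neg (by rwa [← e1]), sub_zero] at this
        rw [map_smul, coeff_smul, e2, evalRel_single, this, smul_zero]
      · intro hz'
        rw [Finsupp.notMem_support_iff.1 hz', zero_smul, map_zero, coeff_zero]
    subst ha0
    simp only [map_zero, add_zero] at hr0 ⊢
    rw [map_add, hy1', zero_add] at hr0
    exact N.add_mem hy1 (ih y2 hy2 hr0)

end IsQuadraticBasis

end WeightedBasis

/-! ### Standard monomials and the apolar ideals of the determinant and the permanent. -/

section Apolar

variable {k : Type*} [Field k] {n : ℕ}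

/-- The exponent of the leading monomial `X_{i,j} X_{i',j'}` of a generator. -/
def leadExp (p : QuadricIndex n) : Fin n × Fin n →₀ ℕ :=
  Finsupp.single (p.1.1.1, p.2.1.1) 1 + Finsupp.single (p.1.1.2, p.2.1.2) 1

/-- The weight of the variable `X_{i,j}` is `i * j`. -/
def cellWeight (u : Fin n × Fin n) : ℕ := u.1 * u.2

/-- The exponent of the monomial `∏ j, x_{s j, j}`. -/
def permExp (s : Equiv.Perm (Fin n)) : Fin n × Fin n →₀ ℕ := ∑ j, Finsupp.single (s j, j) 1

/-- The sum of the monomials of all permutations with coefficients `χ`. -/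
def permSum (χ : Equiv.Perm (Fin n) → k) : MvPolynomial (Fin n × Fin n) k :=
  ∑ s, monomial (permExp s) (χ s)

theorem permExp_apply (s : Equiv.Perm (Fin n)) (i j : Fin n) :
    permExp s (i, j) = if s j = i then 1 else 0 := by
  classical
  rw [permExp, Finsupp.finsetSum_apply, Finset.sum_eq_single j]
  · simp [Finsupp.single_apply]
  · intro b _ hb
    simp [hb]
  · simp

theorem permExp_injective : Function.Injective (permExp (n := n)) := by
  intro s t h
  ext j
  have := DFunLike.congr_fun h (s j, j)
  rw [permExp_apply, permExp_apply, if_pos rfl] at this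
  by_contra hne
  rw [if_neg fun h => hne (by rw [h])] at this
  exact one_ne_zero this

theorem monomial_permExp (s : Equiv.Perm (Fin n)) (c : k) :
    monomial (permExp s) c = C c * ∏ j, X (s j, j) := by
  rw [← mul_one c, ← C_mul_monomial, mul_one, permExp, monomial_sum_one]
  rfl

theorem detPoly_eq_permSum :
    detPoly k n = permSum fun s => ((Equiv.Perm.sign s : ℤ) : k) := by
  rw [detPoly, Matrix.det_apply', permSum]
  refine Finset.sum_congr rfl fun s _ => ?_
  rw [monomial_permExp]
  simp

theorem permPoly_eq_permSum : permPoly k n = permSum fun _ => 1 := by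
  rw [permPoly, Matrix.permanent, permSum]
  refine Finset.sum_congr rfl fun s _ => ?_
  rw [monomial_permExp]
  simp

theorem coeff_permSum (χ : Equiv.Perm (Fin n) → k) (m : Fin n × Fin n →₀ ℕ) :
    coeff m (permSum χ) = ∑ s, if permExp s = m then χ s else 0 := by
  classical
  simp [permSum, coeff_sum, coeff_monomial]

theorem perm_eq_of_single_add {s : Equiv.Perm (Fin n)} {i j : Fin n} {b : Fin n × Fin n →₀ ℕ}
    (h : permExp s = Finsupp.single (i, j) 1 + b) : s j = i := by
  have := DFunLike.congr_fun h (i, j)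
  rw [permExp_apply, Finsupp.add_apply, Finsupp.single_eq_same] at this
  by_contra hne
  rw [if_neg hne] at this
  omega

theorem ne_of_permExp_eq {s : Equiv.Perm (Fin n)} {i i' j j' : Fin n} {b : Fin n × Fin n →₀ ℕ}
    (h : permExp s = Finsupp.single (i, j) 1 + Finsupp.single (i', j') 1 + b) :
    i ≠ i' ∧ j ≠ j' := by
  have h1 := perm_eq_of_single_add (by rwa [add_assoc] at h : permExp s = _ + _)
  have h2 := perm_eq_of_single_add
    (by rwa [add_comm (Finsupp.single (i, j) 1), add_assoc] at h : permExp s = _ + _)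
  have key : ¬ (i = i' ∧ j = j') := by
    rintro ⟨rfl, rfl⟩
    have := DFunLike.congr_fun h (i, j)
    rw [permExp_apply, if_pos h1] at this
    simp at this
    omega
  constructor
  · rintro rfl
    exact key ⟨rfl, s.injective (h1.trans h2.symm)⟩
  · rintro rfl
    exact key ⟨h1.symm.trans h2, rfl⟩

theorem permExp_mul_swap (s : Equiv.Perm (Fin n)) {j j' : Fin n} (hj : j ≠ j') :
    permExp (s * Equiv.swap j j') + (Finsupp.single (s j, j) 1 + Finsupp.single (s j', j') 1)
      = permExp s + (Finsupp.single (s j, j') 1 + Finsupp.single (s j', j) 1) := by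
  classical
  ext ⟨a, b⟩
  simp only [Finsupp.add_apply, permExp_apply, Finsupp.single_apply, Prod.mk.injEq,
    Equiv.Perm.mul_apply]
  by_cases h1 : b = j
  · subst h1
    simp only [Equiv.swap_apply_left, hj.symm, and_false, and_true, if_false]
    omega
  · by_cases h2 : b = j'
    · subst h2
      simp only [Equiv.swap_apply_right, hj, and_false, and_true, if_false]
      omega
    · simp [Equiv.swap_apply_of_ne_of_ne h1 h2, Ne.symm h1, Ne.symm h2]

/-- Right multiplication by the transposition matches the permutations through the two antidiagonal
cells with those through the two diagonal cells, leaving the complementary monomial `b` unchanged.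
-/
theorem permExp_mul_swap_iff (s : Equiv.Perm (Fin n)) {i i' j j' : Fin n} (hj : j ≠ j')
    (b : Fin n × Fin n →₀ ℕ) :
    permExp (s * Equiv.swap j j') = Finsupp.single (i, j') 1 + Finsupp.single (i', j) 1 + b ↔
      permExp s = Finsupp.single (i, j) 1 + Finsupp.single (i', j') 1 + b := by
  have hsw := permExp_mul_swap s hj
  constructor
  · intro h
    have h1 := perm_eq_of_single_add (by rwa [add_assoc] at h : permExp _ = _ + _)
    have h2 := perm_eq_of_single_add
      (by rwa [add_comm (Finsupp.single (i, j') 1), add_assoc] at h : permExp _ = _ + _)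
    simp only [Equiv.Perm.mul_apply, Equiv.swap_apply_right, Equiv.swap_apply_left] at h1 h2
    rw [h1, h2, h] at hsw
    refine add_right_cancel (b := Finsupp.single (i, j') 1 + Finsupp.single (i', j) 1) ?_
    rw [← hsw]
    abel
  · intro h
    have h1 := perm_eq_of_single_add (by rwa [add_assoc] at h : permExp _ = _ + _)
    have h2 := perm_eq_of_single_add
      (by rwa [add_comm (Finsupp.single (i, j) 1), add_assoc] at h : permExp _ = _ + _)
    rw [h1, h2, h] at hsw
    refine add_right_cancel (b := Finsupp.single (i, j) 1 + Finsupp.single (i', j') 1) ?_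
    rw [hsw]
    abel

theorem contract_eq_zero_iff {σ : Type*} (g f : MvPolynomial σ k) :
    contract g f = 0 ↔ ∀ b, ∑ a ∈ g.support, coeff a g * coeff (a + b) f = 0 := by
  rw [MvPolynomial.ext_iff]
  refine forall_congr' fun b => ?_
  simp [contract, coeff_sum, coeff_smul, coeff_divMonomial]

theorem contract_smul_left {σ : Type*} (a : k) (g f : MvPolynomial σ k) :
    contract (a • g) f = a • contract g f := by
  rw [contract_eq_sum (a • g) f g.support (support_smul), contract, Finset.smul_sum]
  refine Finset.sum_congr rfl fun m _ => ?_
  rw [coeff_smul, smul_assoc]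

theorem X_mul_X_eq_monomial {σ : Type*} (u v : σ) :
    (X u * X v : MvPolynomial σ k) = monomial (Finsupp.single u 1 + Finsupp.single v 1) 1 := by
  rw [X, X, monomial_mul, one_mul]

/-- For a binomial quadric the terms cancel in pairs `s`, `s * swap j j'`, since `ε * (-ε) = -1`. A
monomial quadric contracts to zero because no permutation uses a cell twice or two cells of one row
or column. -/
theorem shafieiQuadric_mem_apolarIdeal {ε : k} (hε : ε * ε = 1) {χ : Equiv.Perm (Fin n) → k}
    (hχ : ∀ s j j', j ≠ j' → χ (s * Equiv.swap j j') = -ε * χ s) (p : QuadricIndex n) :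
    shafieiQuadric ε p ∈ apolarIdeal (permSum χ) := by
  obtain ⟨⟨⟨i, i'⟩, hi⟩, ⟨⟨j, j'⟩, hj⟩⟩ := p
  change contract _ _ = 0
  simp only at hi hj
  simp only [shafieiQuadric]
  split_ifs with h
  · rw [contract_add_left, contract_smul_left, X_mul_X_eq_monomial, X_mul_X_eq_monomial,
      contract_monomial, contract_monomial, one_smul, one_smul]
    ext b
    rw [coeff_add, coeff_smul, coeff_divMonomial, coeff_divMonomial, coeff_permSum, coeff_permSum,
      ← Equiv.sum_comp (Equiv.mulRight (Equiv.swap j j')) (fun s => if permExp s =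
        Finsupp.single (i, j') 1 + Finsupp.single (i', j) 1 + b then χ s else 0), smul_eq_mul,
      Finset.mul_sum, ← Finset.sum_add_distrib, coeff_zero]
    refine Finset.sum_eq_zero fun s _ => ?_
    simp only [Equiv.coe_mulRight, permExp_mul_swap_iff s h.2.ne, hχ s j j' h.2.ne]
    split_ifs
    · linear_combination (-χ s) * hε
    · simp
  · rw [X_mul_X_eq_monomial, contract_monomial, one_smul]
    ext b
    rw [coeff_divMonomial, coeff_permSum, coeff_zero]
    refine Finset.sum_eq_zero fun s _ => if_neg fun hs => h ?_
    obtain ⟨h1, h2⟩ := ne_of_permExp_eq hs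
    exact ⟨lt_of_le_of_ne hi h1, lt_of_le_of_ne hj h2⟩

theorem single_add_single_le {σ : Type*} {m : σ →₀ ℕ} {u v : σ} (hu : m u ≠ 0) (hv : m v ≠ 0)
    (huv : u ≠ v) : Finsupp.single u 1 + Finsupp.single v 1 ≤ m := by
  classical
  intro x
  rw [Finsupp.add_apply, Finsupp.single_apply, Finsupp.single_apply]
  split_ifs with h1 h2
  · exact (huv (h1.trans h2.symm)).elim
  · subst h1; omega
  · subst_vars; omega
  · omega

theorem not_single_add_single_le {m : Fin n × Fin n →₀ ℕ} (hm : IsStandard leadExp m)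
    {u v : Fin n × Fin n} (h1 : u.1 ≤ v.1) (h2 : u.2 ≤ v.2) :
    ¬ Finsupp.single u 1 + Finsupp.single v 1 ≤ m :=
  hm (⟨(u.1, v.1), h1⟩, ⟨(u.2, v.2), h2⟩)

theorem IsStandard.le_one {m : Fin n × Fin n →₀ ℕ} (hm : IsStandard leadExp m)
    (u : Fin n × Fin n) : m u ≤ 1 := by
  by_contra h
  refine not_single_add_single_le hm (u := u) le_rfl le_rfl ?_
  rw [← Finsupp.single_add]
  exact Finsupp.single_le_iff.2 (by omega)

/-- Two distinct cells of the support are incomparable in the product order, so going down means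
going left. -/
theorem IsStandard.lt_iff {m : Fin n × Fin n →₀ ℕ} (hm : IsStandard leadExp m)
    {u v : Fin n × Fin n} (hu : m u ≠ 0) (hv : m v ≠ 0) : u.1 < v.1 ↔ v.2 < u.2 := by
  by_cases huv : u = v
  · subst huv; simp
  constructor
  · intro h
    by_contra h'
    exact not_single_add_single_le hm h.le (not_lt.1 h') (single_add_single_le hu hv huv)
  · intro h
    by_contra h'
    exact not_single_add_single_le hm (not_lt.1 h') h.le
      (single_add_single_le hv hu (Ne.symm huv))

theorem IsStandard.eq_of_fst_eq {m : Fin n × Fin n →₀ ℕ} (hm : IsStandard leadExp m)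
    {u v : Fin n × Fin n} (hu : m u ≠ 0) (hv : m v ≠ 0) (h : u.1 = v.1) : u = v := by
  refine Prod.ext h (le_antisymm ?_ ?_)
  · exact not_lt.1 fun h' => h.not_lt ((hm.lt_iff hu hv).2 h')
  · exact not_lt.1 fun h' => h.symm.not_lt ((hm.lt_iff hv hu).2 h')

theorem IsStandard.eq_of_snd_eq {m : Fin n × Fin n →₀ ℕ} (hm : IsStandard leadExp m)
    {u v : Fin n × Fin n} (hu : m u ≠ 0) (hv : m v ≠ 0) (h : u.2 = v.2) : u = v := by
  refine Prod.ext (le_antisymm ?_ ?_) h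
  · exact not_lt.1 fun h' => h.not_lt ((hm.lt_iff hv hu).1 h')
  · exact not_lt.1 fun h' => h.symm.not_lt ((hm.lt_iff hu hv).1 h')

/-- The number of cells above a cell of a standard monomial is the number of cells to its
right. -/
theorem IsStandard.sum_lt {m : Fin n × Fin n →₀ ℕ} (hm : IsStandard leadExp m)
    {i j : Fin n} (hu : m (i, j) ≠ 0) :
    ∑ a, (if a < i then ∑ b, m (a, b) else 0) = ∑ b, (if j < b then ∑ a, m (a, b) else 0) := by
  have e1 : ∀ a, (if a < i then ∑ b, m (a, b) else 0) = ∑ b, if a < i then m (a, b) else 0 := by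
    intro a; split_ifs <;> simp
  have e2 : ∀ b, (if j < b then ∑ a, m (a, b) else 0) = ∑ a, if j < b then m (a, b) else 0 := by
    intro a; split_ifs <;> simp
  simp only [e1, e2]
  rw [Finset.sum_comm]
  refine Finset.sum_congr rfl fun b _ => Finset.sum_congr rfl fun a _ => ?_
  by_cases h : m (a, b) = 0
  · simp [h]
  · simp only [hm.lt_iff h hu]

/-- By `sum_lt`, the row and column sums fix how much lies to the right of the cell in row `i`. If
`j < j'`, the count to the right of `j` would exceed that of `j'` by at least the nonempty column
`j'`. -/
theorem IsStandard.snd_eq {m m' : Fin n × Fin n →₀ ℕ} (hm : IsStandard leadExp m)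
    (hm' : IsStandard leadExp m') (hrow : ∀ i, ∑ j, m (i, j) = ∑ j, m' (i, j))
    (hcol : ∀ j, ∑ i, m (i, j) = ∑ i, m' (i, j)) {i j j' : Fin n} (h : m (i, j) ≠ 0)
    (h' : m' (i, j') ≠ 0) : j' ≤ j := by
  by_contra hlt
  rw [not_le] at hlt
  have e := hm.sum_lt h
  have e' := hm'.sum_lt h'
  simp only [hrow, hcol] at e
  rw [e'] at e
  have : ∑ b, (if j' < b then ∑ a, m' (a, b) else 0) < ∑ b, (if j < b then ∑ a, m' (a, b) else 0) := by
    refine Finset.sum_lt_sum (fun b _ => ?_) ⟨j', Finset.mem_univ _, ?_⟩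
    · split_ifs with h1 h2
      · exact le_rfl
      · exact (h2 (hlt.trans h1)).elim
      · exact Nat.zero_le _
      · exact le_rfl
    · rw [if_neg (lt_irrefl _), if_pos hlt]
      exact lt_of_lt_of_le (Nat.pos_of_ne_zero h')
        (Finset.single_le_sum (f := fun a => m' (a, j')) (fun _ _ => Nat.zero_le _)
          (Finset.mem_univ i))
  omega

theorem IsStandard.ne_zero_of_ne_zero {m m' : Fin n × Fin n →₀ ℕ} (hm : IsStandard leadExp m)
    (hm' : IsStandard leadExp m') (hrow : ∀ i, ∑ j, m (i, j) = ∑ j, m' (i, j))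
    (hcol : ∀ j, ∑ i, m (i, j) = ∑ i, m' (i, j)) {u : Fin n × Fin n} (h : m u ≠ 0) :
    m' u ≠ 0 := by
  obtain ⟨i, j⟩ := u
  have h1 : ∑ j, m (i, j) ≠ 0 := fun h0 => h (Finset.sum_eq_zero_iff.1 h0 j (Finset.mem_univ _))
  rw [hrow] at h1
  obtain ⟨j', -, hj'⟩ := Finset.exists_ne_zero_of_sum_ne_zero h1
  rwa [le_antisymm (hm'.snd_eq hm (fun i => (hrow i).symm) (fun j => (hcol j).symm) hj' h)
    (hm.snd_eq hm' hrow hcol h hj')]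

/-- A standard monomial is determined by its degrees in the rows and columns. -/
theorem IsStandard.ext {m m' : Fin n × Fin n →₀ ℕ} (hm : IsStandard leadExp m)
    (hm' : IsStandard leadExp m') (hrow : ∀ i, ∑ j, m (i, j) = ∑ j, m' (i, j))
    (hcol : ∀ j, ∑ i, m (i, j) = ∑ i, m' (i, j)) : m = m' := by
  ext u
  have h1 := hm.le_one u
  have h2 := hm'.le_one u
  have h3 := hm.ne_zero_of_ne_zero hm' hrow hcol (u := u)
  have h4 := hm'.ne_zero_of_ne_zero hm (fun i => (hrow i).symm) (fun j => (hcol j).symm) (u := u)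
  omega

/-- The support is a partial injection from columns to rows, which extends to a permutation. -/
theorem IsStandard.exists_le_permExp {m : Fin n × Fin n →₀ ℕ} (hm : IsStandard leadExp m) :
    ∃ s, m ≤ permExp s := by
  classical
  have hf : Function.Injective fun u : {u // m u ≠ 0} => u.1.2 :=
    fun u v h => Subtype.ext (hm.eq_of_snd_eq u.2 v.2 h)
  have hg : Function.Injective fun u : {u // m u ≠ 0} => u.1.1 :=
    fun u v h => Subtype.ext (hm.eq_of_fst_eq u.2 v.2 h)
  obtain ⟨s, hs⟩ := Equiv.Perm.exists_extending_pair _ _ hf hg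
  refine ⟨s, fun u => ?_⟩
  by_cases h : m u = 0
  · rw [h]; exact Nat.zero_le _
  · have : s u.2 = u.1 := hs ⟨u, h⟩
    rw [← Prod.mk.eta (p := u), permExp_apply, if_pos this]
    exact hm.le_one u

theorem sum_row_permExp (s : Equiv.Perm (Fin n)) (i : Fin n) : ∑ j, permExp s (i, j) = 1 := by
  simp only [permExp_apply]
  rw [Finset.sum_eq_single (s.symm i)]
  · simp
  · intro j _ hj
    rw [if_neg]
    rintro rfl
    simp at hj
  · simp

theorem sum_col_permExp (s : Equiv.Perm (Fin n)) (j : Fin n) : ∑ i, permExp s (i, j) = 1 := by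
  simp [permExp_apply]

theorem isStandard_of_mem_standardSpan {σ ι : Type*} {lead : ι → σ →₀ ℕ} {D : Set ℕ}
    {f : MvPolynomial σ k} (hf : f ∈ standardSpan k lead D) {m : σ →₀ ℕ}
    (hm : coeff m f ≠ 0) : IsStandard lead m ∧ m.degree ∈ D := by
  classical
  by_contra h
  refine hm ?_
  induction hf using Submodule.span_induction with
  | mem x hx =>
    obtain ⟨m', h1, h2, rfl⟩ := hx
    rw [coeff_monomial, if_neg]
    rintro rfl
    exact h ⟨h1, h2⟩
  | zero => simp
  | add x y _ _ hx hy =>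
    rw [coeff_add]
    by_cases h1 : coeff m x = 0 <;> by_cases h2 : coeff m y = 0 <;> simp_all
  | smul a x _ hx =>
    rw [coeff_smul]
    by_cases h1 : coeff m x = 0 <;> simp_all

/-- Complete a standard monomial `m` of `f` to a permutation monomial by `b`, and read the
coefficient at `b` of the contraction. Another standard monomial that `b` completes to a permutation
has the same row and column sums as `m`, so it equals `m`; the coefficient is therefore a nonzero
multiple of that of `m`. -/
theorem eq_zero_of_mem_apolarIdeal {χ : Equiv.Perm (Fin n) → k} (hχ : ∀ s, χ s ≠ 0)
    {f : MvPolynomial (Fin n × Fin n) k} (hf : f ∈ apolarIdeal (permSum χ))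
    (hstd : f ∈ standardSpan k leadExp Set.univ) : f = 0 := by
  classical
  by_contra hne
  obtain ⟨m, hm⟩ := MvPolynomial.ne_zero_iff.1 hne
  have hms := (isStandard_of_mem_standardSpan hstd hm).1
  obtain ⟨s, hs⟩ := hms.exists_le_permExp
  obtain ⟨b, hb⟩ := exists_add_of_le hs
  have h0 := (contract_eq_zero_iff _ _).1 hf b
  rw [Finset.sum_eq_single m] at h0
  · refine (mul_ne_zero hm ?_) h0
    rw [← hb, coeff_permSum, Finset.sum_eq_single s]
    · simpa using hχ s
    · intro t _ hts
      rw [if_neg fun h => hts (permExp_injective h)]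
    · simp
  · intro m' hm' hne'
    refine mul_eq_zero_of_right _ ?_
    rw [coeff_permSum]
    refine Finset.sum_eq_zero fun t _ => if_neg fun ht => hne' ?_
    refine (isStandard_of_mem_standardSpan hstd (mem_support_iff.1 hm')).1.ext hms ?_ ?_
    · intro i
      have e1 := sum_row_permExp t i
      have e2 := sum_row_permExp s i
      rw [ht] at e1
      rw [hb] at e2
      simp only [Finsupp.add_apply, Finset.sum_add_distrib] at e1 e2
      omega
    · intro j
      have e1 := sum_col_permExp t j
      have e2 := sum_col_permExp s j
      rw [ht] at e1
      rw [hb] at e2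
      simp only [Finsupp.add_apply, Finset.sum_add_distrib] at e1 e2
      omega
  · intro hm'
    exact (hm' (mem_support_iff.2 hm)).elim

theorem shafieiQuadric_tail (ε : k) (p : QuadricIndex n) :
    shafieiQuadric ε p - monomial (leadExp p) 1
      ∈ monosBelow k cellWeight {2} (Finsupp.weight cellWeight (leadExp p)) := by
  obtain ⟨⟨⟨i, i'⟩, hi⟩, ⟨⟨j, j'⟩, hj⟩⟩ := p
  simp only [shafieiQuadric, leadExp]
  split_ifs with h
  · rw [X_mul_X_eq_monomial, add_sub_cancel_left, X_mul_X_eq_monomial]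
    refine Submodule.smul_mem _ _ (Submodule.subset_span ⟨_, ?_, ?_, rfl⟩)
    · simp [Finsupp.degree_single]
    -- The weights differ by `(i' - i) * (j' - j) > 0`.
    · simp only [map_add, Finsupp.weight_single, cellWeight, one_smul]
      obtain ⟨h1, h2⟩ := h
      have h1 : (i : ℕ) < i' := h1
      have h2 : (j : ℕ) < j' := h2
      nlinarith
  · rw [X_mul_X_eq_monomial, sub_self]
    exact zero_mem _

theorem isQuadraticBasis_shafieiQuadric {ε : k} (hε : ε * ε = 1) {χ : Equiv.Perm (Fin n) → k}
    (hχ0 : ∀ s, χ s ≠ 0) (hχ : ∀ s j j', j ≠ j' → χ (s * Equiv.swap j j') = -ε * χ s) :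
    IsQuadraticBasis cellWeight leadExp (shafieiQuadric (n := n) ε) (apolarIdeal (permSum χ)) where
  degree_lead p := by simp [leadExp, Finsupp.degree_single]
  tail_mem := shafieiQuadric_tail ε
  mem := shafieiQuadric_mem_apolarIdeal hε hχ
  eq_zero _ := eq_zero_of_mem_apolarIdeal hχ0

theorem isQuadraticBasis_detQuadric : IsQuadraticBasis cellWeight leadExp
    (shafieiQuadric (n := n) (1 : k)) (apolarIdeal (detPoly k n)) := by
  rw [detPoly_eq_permSum]
  refine isQuadraticBasis_shafieiQuadric (one_mul 1) (fun s => ?_) fun s j j' h => ?_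
  · rcases Int.units_eq_one_or (Equiv.Perm.sign s) with h | h <;> simp [h]
  · simp [Equiv.Perm.sign_mul, Equiv.Perm.sign_swap h]

theorem isQuadraticBasis_permQuadric : IsQuadraticBasis cellWeight leadExp
    (shafieiQuadric (n := n) (-1 : k)) (apolarIdeal (permPoly k n)) := by
  rw [permPoly_eq_permSum]
  exact isQuadraticBasis_shafieiQuadric (by ring) (fun s => one_ne_zero) fun s j j' h => by simp

end Apolar

/-! ### Koszul relations as formal consequences of linear relations. -/

section LinearRelations

variable {R M I J : Type*} [CommRing R] [AddCommGroup M] [Module R M]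

/-- The consequences of the linear relations between the symmetrized quadrics
`x i j * x i' j' + ε * x i j' * x i' j`, in a module generated by symbols `e i i' j j'`. -/
structure LinearRelations (ε : R) (x : I → J → R) (e : I → I → J → J → M) : Prop where
  symm : ∀ i i' j j', e i' i j' j = e i i' j j'
  swap : ∀ i i' j j', i ≠ i' → j ≠ j' → e i i' j' j = ε • e i i' j j'
  three : ∀ i i' k j j' l, i ≠ i' → i ≠ k → i' ≠ k → j ≠ j' → j ≠ l → j' ≠ l →
    x k l • e i i' j j' = x i' j' • e i k j l - (ε * x i l) • e i' k j' j
      + (ε * x i' j) • e i k j' l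
  two : ∀ k i l a b, k ≠ i → a ≠ b →
    x k l • e k i a b = x i b • e k k l a + (ε * x i a) • e k k l b
  two_col : ∀ k i l j, k ≠ i → x k l • e i k j j = x i j • e k k j l
  col : ∀ k i i' l j, k ≠ i → k ≠ i' → l ≠ j →
    x k l • e i i' j j = x i' j • e i k j l - (ε * x i l) • e i' k j j

namespace LinearRelations

variable {ε : R} {x : I → J → R} {e : I → I → J → J → M}

/-- One variable is moved at a time: `col` splits off `x k l`, then `two` and `two_col`, multiplied
by the other variables, bring every symbol into row `k`. -/
theorem koszul_row_col (h : LinearRelations ε x e) {i i' k : I} {j l l' : J}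
    (h1 : k ≠ i) (h2 : k ≠ i') (h3 : l ≠ j) :
    (x k l * x k l') • e i i' j j = (x i j * x i' j) • e k k l l' := by
  have e1 := h.col k i i' l j h1 h2 h3
  have e2 := h.two k i l' l j h1 h3
  rw [h.symm i k j l] at e2
  have e3 := h.two_col k i' l' j h2
  have e4 := h.symm k k l l'
  have e5 := h.symm k k l' j
  linear_combination (norm := module) x k l' • e1 + x i' j • e2 - (ε * x i l) • e3
    + (x i j * x i' j) • e4 - (ε * x i l * x i' j) • e5

theorem koszul_row_generic (h : LinearRelations ε x e) {i i' k : I}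
    {j j' l l' : J} (hi : i ≠ i') (hj : j ≠ j') (h1 : i ≠ k) (h2 : i' ≠ k) (h3 : j ≠ l)
    (h4 : j' ≠ l) :
    (x k l * x k l') • e i i' j j' = (x i j * x i' j' + ε * (x i j' * x i' j)) • e k k l l' := by
  have e1 := h.three i i' k j j' l hi h1 h2 hj h3 h4
  have e2 := h.two k i l' l j h1.symm h3.symm
  rw [h.symm i k j l] at e2
  have e3 := h.two k i' l' j j' h2.symm hj
  rw [h.symm i' k j' j] at e3
  have e4 := h.two k i l' l j' h1.symm h4.symm
  rw [h.symm i k j' l] at e4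
  have e5 := h.symm k k l l'
  linear_combination (norm := module) x k l' • e1 + x i' j' • e2 - (ε * x i l) • e3
    + (ε * x i' j) • e4 + (x i j * x i' j' + ε * (x i j' * x i' j)) • e5

theorem koszul_generic (h : LinearRelations ε x e) (hε : ε * ε = 1) {i₀ i₁ i₂ i₃ : I}
    {j₀ j₁ j₂ j₃ : J} (h01 : i₀ ≠ i₁) (h02 : i₀ ≠ i₂) (h03 : i₀ ≠ i₃) (h12 : i₁ ≠ i₂)
    (h13 : i₁ ≠ i₃) (h23 : i₂ ≠ i₃) (g01 : j₀ ≠ j₁) (g02 : j₀ ≠ j₂) (g03 : j₀ ≠ j₃)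
    (g12 : j₁ ≠ j₂) (g13 : j₁ ≠ j₃) (g23 : j₂ ≠ j₃) :
    (x i₂ j₂ * x i₃ j₃ + ε * (x i₂ j₃ * x i₃ j₂)) • e i₀ i₁ j₀ j₁
      = (x i₀ j₀ * x i₁ j₁ + ε * (x i₀ j₁ * x i₁ j₀)) • e i₂ i₃ j₂ j₃ := by
  have hsymm : ∀ i i' j j', i ≠ i' → j ≠ j' → e i' i j j' = ε • e i i' j j' := by
    intro i i' j j' hi hj
    rw [← h.swap i i' j j' hi hj, h.symm]
  have hz : ∀ v : M, (ε * ε) • v = v := fun v => by rw [hε, one_smul]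
  have t1 := h.three i₀ i₁ i₂ j₀ j₁ j₂ h01 h02 h12 g01 g02 g12
  have t2 := h.three i₂ i₀ i₃ j₁ j₂ j₃ h02.symm h23 h03 g12 g13 g23
  have t3 := h.three i₂ i₀ i₃ j₀ j₂ j₃ h02.symm h23 h03 g02 g03 g23
  have t4 := h.three i₀ i₁ i₃ j₀ j₁ j₂ h01 h03 h13 g01 g02 g12
  have t5 := h.three i₂ i₁ i₃ j₀ j₁ j₃ h12.symm h23 h13 g01 g03 g13
  rw [h.swap _ _ _ _ h12 g01] at t1
  rw [h.swap _ _ _ _ h03 g12, hsymm _ _ _ _ h02 g12] at t2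
  rw [h.swap _ _ _ _ h03 g02, hsymm _ _ _ _ h02 g02] at t3
  rw [h.swap _ _ _ _ h13 g01] at t4
  rw [h.swap _ _ _ _ h13 g01, hsymm _ _ _ _ h12 g01] at t5
  -- `t1` and `t4` expand the two terms of the left side. `t2`, `t3` and `t5` rewrite the symbols
  -- produced by `t1`, multiplied by `x i₃ j₃`; the symbols in rows `i₀, i₃` and `i₁, i₃` then
  -- cancel against those from `t4`. The `hz` terms only remove factors `ε * ε`.
  linear_combination (norm := module) x i₃ j₃ • t1 + x i₁ j₀ • t2 + (ε * x i₁ j₁) • t3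
    + (ε * x i₂ j₃) • t4 - (ε * x i₀ j₂) • t5
    - (x i₃ j₃ * x i₁ j₁) • hz (e i₀ i₂ j₀ j₂) + (x i₀ j₀ * x i₁ j₁) • hz (e i₂ i₃ j₂ j₃)
    - (ε * x i₁ j₁ * x i₂ j₃) • hz (e i₀ i₃ j₀ j₂)
    - (x i₁ j₀ * x i₀ j₂) • hz (e i₂ i₃ j₁ j₃)

/-- The Koszul relation of two monomials in different rows. -/
def rowDefect (x : I → J → R) (e : I → I → J → J → M) (i k : I) (a b c d : J) : M :=
  (x k c * x k d) • e i i a b - (x i a * x i b) • e k k c d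

/-- The element `x i b * x k d` times the symbol on rows `i, k` and columns `a, c` can be expanded
by `two` into row `i` or into row `k`; equating the two expansions gives the claim. -/
theorem rowDefect_swap (h : LinearRelations ε x e) {i k : I} {a b c d : J} (hik : i ≠ k)
    (hac : a ≠ c) : rowDefect x e i k a b c d = -ε • rowDefect x e i k c b a d := by
  have e1 := h.two i k b a c hik hac
  have e2 := h.two k i d c a hik.symm hac.symm
  rw [h.symm i k a c] at e2
  have e3 := h.symm i i a b
  have e4 := h.symm i i c b
  have e5 := h.symm k k c d
  have e6 := h.symm k k a d
  simp only [rowDefect]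
  linear_combination (norm := module) (-x k d) • e1 + x i b • e2 - (x k c * x k d) • e3
    - (ε * x k a * x k d) • e4 + (x i a * x i b) • e5 + (ε * x i b * x i c) • e6

theorem rowDefect_symm_left (h : LinearRelations ε x e) (i k : I) (a b c d : J) :
    rowDefect x e i k b a c d = rowDefect x e i k a b c d := by
  rw [rowDefect, rowDefect, h.symm i i a b, mul_comm (x i a)]

theorem rowDefect_symm_right (h : LinearRelations ε x e) (i k : I) (a b c d : J) :
    rowDefect x e i k a b d c = rowDefect x e i k a b c d := by
  rw [rowDefect, rowDefect, h.symm k k c d, mul_comm (x k c)]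

/-- For `ε = 1` an exchange between the rows changes the sign, while an exchange within a row does
not. The transposition of `a` and `b` within a row is also a product of three exchanges between the
rows, so the defect equals its negative. -/
theorem two_smul_rowDefect (h : LinearRelations 1 x e) {i k : I} {a b c d : J} (hik : i ≠ k)
    (hac : a ≠ c) (hbc : b ≠ c) (hab : a ≠ b) :
    (2 : R) • rowDefect x e i k a b c d = 0 := by
  have e1 := h.rowDefect_swap (b := b) (d := d) hik hac
  have e2 := h.rowDefect_swap (b := a) (d := d) hik hbc
  have e3 := h.rowDefect_swap (b := c) (d := d) hik hab
  rw [h.rowDefect_symm_left _ _ a b] at e2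
  rw [h.rowDefect_symm_left _ _ c a, h.rowDefect_symm_left _ _ c b] at e3
  linear_combination (norm := module) e1 + e2 - e3

/-- For `ε = -1` both kinds of exchange leave the defect unchanged, and transpositions generate the
symmetric group. -/
theorem rowDefect_comp_perm (h : LinearRelations (-1) x e) {i k : I} (hik : i ≠ k)
    (s : Equiv.Perm (Fin 4)) {v : Fin 4 → J} (hv : Function.Injective v) :
    rowDefect x e i k (v (s 0)) (v (s 1)) (v (s 2)) (v (s 3))
      = rowDefect x e i k (v 0) (v 1) (v 2) (v 3) := by
  have hsw : ∀ {a b c d : J}, a ≠ c → rowDefect x e i k c b a d = rowDefect x e i k a b c d := by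
    intro a b c d hac
    rw [h.rowDefect_swap hik hac, neg_neg, one_smul]
  induction s using Equiv.Perm.swap_induction_on' with
  | one => rfl
  | mul_swap f a b hab ih =>
    have hne : ∀ {p q : Fin 4}, p ≠ q → v (f p) ≠ v (f q) := fun h h' => h (f.injective (hv h'))
    have h02 := hne (p := 0) (q := 2) (by decide)
    have h03 := hne (p := 0) (q := 3) (by decide)
    have h12 := hne (p := 1) (q := 2) (by decide)
    have h13 := hne (p := 1) (q := 3) (by decide)
    have h21 := rowDefect_symm_left h i k
    have h43 := rowDefect_symm_right h i k
    rw [← ih]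
    generalize hw : (fun p => v (f p)) = w at *
    simp only [funext_iff] at hw
    simp only [Equiv.Perm.mul_apply, hw] at *
    -- The other exchanges between the rows are conjugates of the one of positions 0 and 2 by the
    -- symmetries within the rows.
    have q12 : rowDefect x e i k (w 0) (w 2) (w 1) (w 3)
        = rowDefect x e i k (w 0) (w 1) (w 2) (w 3) := by rw [h21, hsw h12, h21]
    have q03 : rowDefect x e i k (w 3) (w 1) (w 2) (w 0)
        = rowDefect x e i k (w 0) (w 1) (w 2) (w 3) := by rw [h43, hsw h03, h43]
    have q13 : rowDefect x e i k (w 0) (w 3) (w 2) (w 1)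
        = rowDefect x e i k (w 0) (w 1) (w 2) (w 3) := by rw [h21, h43, hsw h13, h21, h43]
    fin_cases a <;> fin_cases b <;> first | exact absurd rfl hab | skip
    all_goals
      simp [Equiv.swap_apply_def]
      first | exact h21 .. | exact h43 .. | exact hsw h02 | exact q12 | exact q03 | exact q13

end LinearRelations

end LinearRelations

/-! ### Coefficient degrees, and symbols for the quadrics with unordered indices. -/

section HasCoeffDegree

variable {σ ι k : Type*} [Field k] {d e : ℕ} {c c' : ι → MvPolynomial σ k}

theorem HasCoeffDegree.add (h : HasCoeffDegree d c) (h' : HasCoeffDegree d c') :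
    HasCoeffDegree d (c + c') := fun p => (h p).add (h' p)

theorem HasCoeffDegree.sub (h : HasCoeffDegree d c) (h' : HasCoeffDegree d c') :
    HasCoeffDegree d (c - c') := fun p => (h p).sub (h' p)

theorem HasCoeffDegree.smul {f : MvPolynomial σ k} (hf : f.IsHomogeneous e)
    (h : HasCoeffDegree d c) : HasCoeffDegree (e + d) (f • c) := fun p => hf.mul (h p)

theorem HasCoeffDegree.single [DecidableEq ι] (p : ι) {f : MvPolynomial σ k}
    (hf : f.IsHomogeneous d) : HasCoeffDegree d (Pi.single p f : ι → MvPolynomial σ k) := by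
  intro q
  rw [Pi.single_apply]
  split_ifs
  · exact hf
  · exact isHomogeneous_zero _ _ _

end HasCoeffDegree

section QuadricSymbols

variable {k : Type*} [Field k] {n : ℕ}

/-- The weakly increasing pair with the entries `i` and `i'`. -/
def sortPair (i i' : Fin n) : {r : Fin n × Fin n // r.1 ≤ r.2} :=
  ⟨(min i i', max i i'), min_le_max⟩

/-- The basis element of the free module on the quadrics whose value is
`X_{i,j} X_{i',j'} + ε X_{i,j'} X_{i',j}`, for indices in any order. -/
def quadSymbol (ε : k) (i i' j j' : Fin n) : QuadricIndex n → MvPolynomial (Fin n × Fin n) k :=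
  Pi.single (sortPair i i', sortPair j j')
    (if (i < i' ∧ j' < j) ∨ (i' < i ∧ j < j') then C ε else 1)

/-- The variable in row `i` and column `j`, or in row `j` and column `i` if `b` is true. -/
def cellVar (k : Type*) [Field k] (n : ℕ) (b : Bool) (i j : Fin n) :
    MvPolynomial (Fin n × Fin n) k := X (if b then (j, i) else (i, j))

/-- `quadSymbol`, with rows and columns exchanged if `b` is true. -/
def flipSymbol (ε : k) (b : Bool) (i i' j j' : Fin n) :
    QuadricIndex n → MvPolynomial (Fin n × Fin n) k :=
  if b then quadSymbol ε j j' i i' else quadSymbol ε i i' j j'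

@[simp]
theorem flipSymbol_false (ε : k) (i i' j j' : Fin n) :
    flipSymbol ε false i i' j j' = quadSymbol ε i i' j j' := rfl

@[simp]
theorem flipSymbol_true (ε : k) (i i' j j' : Fin n) :
    flipSymbol ε true i i' j j' = quadSymbol ε j j' i i' := rfl

theorem sortPair_comm (i i' : Fin n) : sortPair i' i = sortPair i i' := by
  simp [sortPair, min_comm, max_comm]

theorem sortPair_of_le {i i' : Fin n} (h : i ≤ i') : sortPair i i' = ⟨(i, i'), h⟩ := by
  simp [sortPair, h]

theorem quadSymbol_of_le (ε : k) {i i' j j' : Fin n} (hi : i ≤ i') (hj : j ≤ j') :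
    quadSymbol ε i i' j j' = Pi.single (⟨(i, i'), hi⟩, ⟨(j, j'), hj⟩) 1 := by
  rw [quadSymbol, sortPair_of_le hi, sortPair_of_le hj, if_neg]
  rintro (⟨-, h⟩ | ⟨h, -⟩)
  · exact h.not_ge hj
  · exact h.not_ge hi

theorem quadSymbol_symm (ε : k) (i i' j j' : Fin n) :
    quadSymbol ε i' i j' j = quadSymbol ε i i' j j' := by
  rw [quadSymbol, quadSymbol, sortPair_comm i, sortPair_comm j]
  simp only [or_comm]

theorem quadSymbol_swap {ε : k} (hε : ε * ε = 1) {i i' j j' : Fin n} (hi : i ≠ i') (hj : j ≠ j') :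
    quadSymbol ε i i' j' j = (C ε : MvPolynomial (Fin n × Fin n) k) • quadSymbol ε i i' j j' := by
  rw [quadSymbol, quadSymbol, sortPair_comm j, ← Pi.single_smul]
  congr 1
  have hC : (C ε * C ε : MvPolynomial (Fin n × Fin n) k) = 1 := by rw [← C_mul, hε, C_1]
  rcases lt_or_gt_of_ne hi with h | h <;> rcases lt_or_gt_of_ne hj with h' | h' <;>
    simp [h, h', h.not_gt, h'.not_gt, hC]

theorem evalRel_quadSymbol_of_ne {ε : k} (hε : ε * ε = 1) {i i' j j' : Fin n} (hi : i ≠ i')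
    (hj : j ≠ j') : evalRel (shafieiQuadric ε) (quadSymbol ε i i' j j')
      = X (i, j) * X (i', j') + C ε * (X (i, j') * X (i', j)) := by
  have key : ∀ i i' j j' : Fin n, i < i' → j < j' →
      evalRel (shafieiQuadric ε) (quadSymbol ε i i' j j')
      = X (i, j) * X (i', j') + C ε * (X (i, j') * X (i', j)) := by
    intro i i' j j' h h'
    rw [quadSymbol_of_le ε h.le h'.le, evalRel_single]
    simp [shafieiQuadric, h, h', C_mul']
  have hC : (C ε * C ε : MvPolynomial (Fin n × Fin n) k) = 1 := by rw [← C_mul, hε, C_1]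
  rcases lt_or_gt_of_ne hi with h | h <;> rcases lt_or_gt_of_ne hj with h' | h'
  · exact key _ _ _ _ h h'
  · rw [quadSymbol_swap hε hi hj.symm, evalRel_smul, key _ _ _ _ h h']
    linear_combination (X (i, j) * X (i', j')) * hC
  · rw [← quadSymbol_symm, quadSymbol_swap hε hi.symm hj, evalRel_smul, key _ _ _ _ h h']
    linear_combination (X (i, j) * X (i', j')) * hC
  · rw [← quadSymbol_symm, key _ _ _ _ h h']
    ring

theorem evalRel_quadSymbol_row (ε : k) (i j j' : Fin n) :
    evalRel (shafieiQuadric ε) (quadSymbol ε i i j j') = X (i, j) * X (i, j') := by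
  rcases le_total j j' with h | h
  · rw [quadSymbol_of_le ε le_rfl h, evalRel_single]
    simp [shafieiQuadric]
  · rw [← quadSymbol_symm, quadSymbol_of_le ε le_rfl h, evalRel_single]
    simp [shafieiQuadric, mul_comm]

theorem evalRel_quadSymbol_col (ε : k) (i i' j : Fin n) :
    evalRel (shafieiQuadric ε) (quadSymbol ε i i' j j) = X (i, j) * X (i', j) := by
  rcases le_total i i' with h | h
  · rw [quadSymbol_of_le ε h le_rfl, evalRel_single]
    simp [shafieiQuadric]
  · rw [← quadSymbol_symm, quadSymbol_of_le ε h le_rfl, evalRel_single]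
    simp [shafieiQuadric, mul_comm]

theorem hasCoeffDegree_quadSymbol (ε : k) (i i' j j' : Fin n) :
    HasCoeffDegree 0 (quadSymbol ε i i' j j') := by
  refine HasCoeffDegree.single _ ?_
  split_ifs
  · exact isHomogeneous_C _ _
  · exact isHomogeneous_one _ _

theorem hasCoeffDegree_flipSymbol (ε : k) (b : Bool) (i i' j j' : Fin n) :
    HasCoeffDegree 0 (flipSymbol ε b i i' j j') := by
  cases b
  · exact hasCoeffDegree_quadSymbol ε i i' j j'
  · exact hasCoeffDegree_quadSymbol ε j j' i i'

theorem isHomogeneous_cellVar (b : Bool) (i j : Fin n) : (cellVar k n b i j).IsHomogeneous 1 :=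
  isHomogeneous_X _ _

theorem evalRel_flipSymbol_of_ne {ε : k} (hε : ε * ε = 1) (b : Bool) {i i' j j' : Fin n}
    (hi : i ≠ i') (hj : j ≠ j') : evalRel (shafieiQuadric ε) (flipSymbol ε b i i' j j')
      = cellVar k n b i j * cellVar k n b i' j'
        + C ε * (cellVar k n b i j' * cellVar k n b i' j) := by
  cases b
  · exact evalRel_quadSymbol_of_ne hε hi hj
  · simp only [flipSymbol, cellVar, if_true, evalRel_quadSymbol_of_ne hε hj hi]
    ring

theorem evalRel_flipSymbol_row (ε : k) (b : Bool) (i j j' : Fin n) :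
    evalRel (shafieiQuadric ε) (flipSymbol ε b i i j j')
      = cellVar k n b i j * cellVar k n b i j' := by
  cases b
  · exact evalRel_quadSymbol_row ε i j j'
  · exact evalRel_quadSymbol_col ε j j' i

theorem evalRel_flipSymbol_col (ε : k) (b : Bool) (i i' j : Fin n) :
    evalRel (shafieiQuadric ε) (flipSymbol ε b i i' j j)
      = cellVar k n b i j * cellVar k n b i' j := by
  cases b
  · exact evalRel_quadSymbol_col ε i i' j
  · exact evalRel_quadSymbol_row ε j i i'

/-- The first two fields hold for the symbols themselves. Each of the others is a polynomial
identity between the values of the symbols with linear coefficients, so it holds modulo any `N`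
containing the linear relations. -/
theorem linearRelations_flipSymbol {ε : k} (hε : ε * ε = 1) (b : Bool)
    {N : Submodule (MvPolynomial (Fin n × Fin n) k)
      (QuadricIndex n → MvPolynomial (Fin n × Fin n) k)}
    (hN : ∀ c, HasCoeffDegree 1 c → evalRel (shafieiQuadric ε) c = 0 → c ∈ N) :
    LinearRelations (C ε) (cellVar k n b)
      (fun i i' j j' => N.mkQ (flipSymbol ε b i i' j j')) := by
  have hC : (C ε * C ε : MvPolynomial (Fin n × Fin n) k) = 1 := by rw [← C_mul, hε, C_1]
  have hQ : ∀ c, HasCoeffDegree 1 c → evalRel (shafieiQuadric ε) c = 0 → N.mkQ c = 0 :=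
    fun c h1 h2 => (Submodule.Quotient.mk_eq_zero N).2 (hN c h1 h2)
  have h1 : ∀ i j i₁ i₂ j₁ j₂, HasCoeffDegree 1
      (cellVar k n b i j • flipSymbol ε b i₁ i₂ j₁ j₂) := fun i j i₁ i₂ j₁ j₂ =>
    HasCoeffDegree.smul (d := 0) (isHomogeneous_cellVar b i j) (hasCoeffDegree_flipSymbol ε b i₁ i₂ j₁ j₂)
  have h2 : ∀ i j i₁ i₂ j₁ j₂, HasCoeffDegree 1
      ((C ε * cellVar k n b i j) • flipSymbol ε b i₁ i₂ j₁ j₂) := fun i j i₁ i₂ j₁ j₂ =>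
    HasCoeffDegree.smul (d := 0) ((isHomogeneous_cellVar b i j).C_mul ε) (hasCoeffDegree_flipSymbol ε b i₁ i₂ j₁ j₂)
  constructor
  · intro i i' j j'
    cases b
    · exact congrArg N.mkQ (quadSymbol_symm ε i i' j j')
    · exact congrArg N.mkQ (quadSymbol_symm ε j j' i i')
  · intro i i' j j' hi hj
    rw [← map_smul]
    congr 1
    cases b
    · exact quadSymbol_swap hε hi hj
    · simp only [flipSymbol, if_true]
      rw [← quadSymbol_symm, quadSymbol_swap hε hj hi]
  · intro i i' l j j' m hi hil hi'l hj hjm hj'm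
    simp only [← map_smul]
    rw [← map_sub, ← map_add, ← sub_eq_zero, ← map_sub]
    refine hQ _ (HasCoeffDegree.sub (h1 _ _ _ _ _ _) (HasCoeffDegree.add (HasCoeffDegree.sub (h1 _ _ _ _ _ _) (h2 _ _ _ _ _ _)) (h2 _ _ _ _ _ _))) ?_
    simp only [map_sub, map_add, evalRel_smul, evalRel_flipSymbol_of_ne hε b hi hj,
      evalRel_flipSymbol_of_ne hε b hil hjm, evalRel_flipSymbol_of_ne hε b hi'l hj.symm,
      evalRel_flipSymbol_of_ne hε b hil hj'm]
    ring
  · intro l i m a a' hl ha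
    simp only [← map_smul]
    rw [← map_add, ← sub_eq_zero, ← map_sub]
    refine hQ _ (HasCoeffDegree.sub (h1 _ _ _ _ _ _) (HasCoeffDegree.add (h1 _ _ _ _ _ _) (h2 _ _ _ _ _ _))) ?_
    simp only [map_sub, map_add, evalRel_smul, evalRel_flipSymbol_of_ne hε b hl ha,
      evalRel_flipSymbol_row]
    ring
  · intro l i m j hl
    simp only [← map_smul]
    rw [← sub_eq_zero, ← map_sub]
    refine hQ _ (HasCoeffDegree.sub (h1 _ _ _ _ _ _) (h1 _ _ _ _ _ _)) ?_
    simp only [map_sub, evalRel_smul, evalRel_flipSymbol_row, evalRel_flipSymbol_col]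
    ring
  · intro l i i' m j hl hl' hj
    simp only [← map_smul]
    rw [← map_sub, ← sub_eq_zero, ← map_sub]
    refine hQ _ (HasCoeffDegree.sub (h1 _ _ _ _ _ _) (HasCoeffDegree.sub (h1 _ _ _ _ _ _) (h2 _ _ _ _ _ _))) ?_
    simp only [map_sub, evalRel_smul, evalRel_flipSymbol_col,
      evalRel_flipSymbol_of_ne hε b hl.symm hj.symm]
    ring

/-- The Koszul relation of two monomials in the rows (or, if `b` is true, columns) `i` and `l`. -/
def koszulRel (ε : k) (b : Bool) (i l : Fin n) (v : Fin 4 → Fin n) :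
    QuadricIndex n → MvPolynomial (Fin n × Fin n) k :=
  LinearRelations.rowDefect (cellVar k n b) (flipSymbol ε b) i l (v 0) (v 1) (v 2) (v 3)

/-- Each quadric is a row monomial, a column monomial or a binomial, and each combination is one of
the formal Koszul identities, possibly transposed. The hypothesis `hK` is used only for two row
monomials or two column monomials with distinct factors; a square is both a row and a column
monomial and falls under `koszul_row_col` or the generic identities. -/
theorem shafieiQuadric_smul_single_mem {ε : k} (hε : ε * ε = 1)
    {N : Submodule (MvPolynomial (Fin n × Fin n) k)
      (QuadricIndex n → MvPolynomial (Fin n × Fin n) k)}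
    (hN : ∀ c, HasCoeffDegree 1 c → evalRel (shafieiQuadric ε) c = 0 → c ∈ N)
    (hK : ∀ b i l v, i ≠ l → Function.Injective v → koszulRel ε b i l v ∈ N)
    {p q : QuadricIndex n}
    (h1 : p.1.1.1 ≠ q.1.1.1) (h2 : p.1.1.1 ≠ q.1.1.2) (h3 : p.1.1.2 ≠ q.1.1.1)
    (h4 : p.1.1.2 ≠ q.1.1.2) (g1 : p.2.1.1 ≠ q.2.1.1) (g2 : p.2.1.1 ≠ q.2.1.2)
    (g3 : p.2.1.2 ≠ q.2.1.1) (g4 : p.2.1.2 ≠ q.2.1.2) :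
    N.mkQ (shafieiQuadric ε p • Pi.single q 1) = N.mkQ (shafieiQuadric ε q • Pi.single p 1) := by
  have hL := linearRelations_flipSymbol hε false hN
  have hL' := linearRelations_flipSymbol hε true hN
  obtain ⟨⟨⟨i, i'⟩, hi⟩, ⟨⟨j, j'⟩, hj⟩⟩ := p
  obtain ⟨⟨⟨l, l'⟩, hl⟩, ⟨⟨m, m'⟩, hm⟩⟩ := q
  simp only at h1 h2 h3 h4 g1 g2 g3 g4 hi hj hl hm
  have ep : ∀ {i i' j j' : Fin n} (hi : i ≤ i') (hj : j ≤ j'),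
      shafieiQuadric ε (⟨(i, i'), hi⟩, ⟨(j, j'), hj⟩) = if i ≠ i' ∧ j ≠ j' then
        cellVar k n false i j * cellVar k n false i' j'
          + C ε * (cellVar k n false i j' * cellVar k n false i' j)
      else cellVar k n false i j * cellVar k n false i' j' := by
    intro i i' j j' hi hj
    simp only [shafieiQuadric, cellVar, C_mul', hi.lt_iff_ne, hj.lt_iff_ne, Bool.false_eq_true,
      if_false]
  have hft : ∀ i j, cellVar k n true i j = cellVar k n false j i := fun _ _ => rfl
  rw [ep hi hj, ep hl hm, ← quadSymbol_of_le ε hi hj, ← quadSymbol_of_le ε hl hm, map_smul,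
    map_smul]
  have hKQ : ∀ b i l a c a' c', i ≠ l → a ≠ c → a ≠ a' → a ≠ c' → c ≠ a' → c ≠ c' → a' ≠ c' →
      (cellVar k n b l a' * cellVar k n b l c') • N.mkQ (flipSymbol ε b i i a c)
        = (cellVar k n b i a * cellVar k n b i c) • N.mkQ (flipSymbol ε b l l a' c') := by
    intro b i l a c a' c' hil e1 e2 e3 e4 e5 e6
    rw [← sub_eq_zero, ← map_smul, ← map_smul, ← map_sub]
    refine (Submodule.Quotient.mk_eq_zero N).2 (hK b i l ![a, c, a', c'] hil ?_)
    intro s t hst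
    fin_cases s <;> fin_cases t <;> simp_all
  by_cases hl' : l = l'
  · subst hl'
    by_cases hj' : j = j'
    · subst hj'
      simpa using (hL.koszul_row_col (l' := m') h1.symm h3.symm g1.symm).symm
    · by_cases hi' : i = i'
      · subst hi'
        by_cases hm' : m = m'
        · subst hm'
          simpa using hL.koszul_row_col (l' := j') h1 h1 g1
        · simpa using (hKQ false i l j j' m m' h1 hj' g1 g2 g3 g4 hm').symm
      · simpa [hi', hj'] using (hL.koszul_row_generic (l' := m') hi' hj' h1 h3 g1 g3).symm
  · by_cases hm' : m = m'
    · subst hm'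
      by_cases hi' : i = i'
      · subst hi'
        simpa [hft] using (hL'.koszul_row_col (l' := l') g1.symm g3.symm h1.symm).symm
      · by_cases hj' : j = j'
        · subst hj'
          simpa [hft] using (hKQ true j m i i' l l' g1 hi' h1 h2 h3 h4 hl').symm
        · have := (hL'.koszul_row_generic (l' := l') hj' hi' g1 g3 h1 h3).symm
          simpa [hi', hj', hft, mul_comm (cellVar k n false i' j)] using this
    · by_cases hi' : i = i'
      · subst hi'
        simpa [hl', hm'] using hL.koszul_row_generic (l' := j') hl' hm' h1.symm h2.symm g1.symm
          g2.symm
      · by_cases hj' : j = j'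
        · subst hj'
          have := hL'.koszul_row_generic (l' := i') hm' hl' g1.symm g2.symm h1.symm h2.symm
          simpa [hl', hm', hft, mul_comm (cellVar k n false l' m)] using this
        · have hC : (C ε * C ε : MvPolynomial (Fin n × Fin n) k) = 1 := by rw [← C_mul, hε, C_1]
          have := hL.koszul_generic hC hi' h1 h2 h3 h4 hl' hj' g1 g2 g3 g4 hm'
          simpa [hi', hj', hl', hm'] using this.symm

end QuadricSymbols

/-! ### Reduction of all S-pairs and generators of the relation modules. -/

section SPairs

variable {k : Type*} [Field k] {n : ℕ}

theorem leadExp_injective : Function.Injective (leadExp (n := n)) := by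
  rintro ⟨⟨⟨i, i'⟩, hi⟩, ⟨⟨j, j'⟩, hj⟩⟩ ⟨⟨⟨l, l'⟩, hl⟩, ⟨⟨m, m'⟩, hm⟩⟩ h
  simp only at hi hj hl hm
  simp only [leadExp, Finsupp.single_add_single_eq_single_add_single one_ne_zero one_ne_zero,
    Prod.mk.injEq] at h
  simp only [Prod.mk.injEq, Subtype.mk.injEq]
  rcases h with ⟨⟨rfl, rfl⟩, rfl, rfl⟩ | ⟨-, ⟨rfl, rfl⟩, rfl, rfl⟩ | ⟨h, -⟩
  · simp
  · exact ⟨⟨le_antisymm hi hl, le_antisymm hl hi⟩, le_antisymm hj hm, le_antisymm hm hj⟩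
  · omega

theorem single_mem_relsBelow {σ ι : Type*} [Fintype ι] [DecidableEq ι] {w : σ → ℕ}
    {lead : ι → σ →₀ ℕ} {D : Set ℕ} {W W' : ℕ} {f : MvPolynomial σ k}
    (hf : f ∈ monosBelow k w D W) (p : ι) (hW : W + Finsupp.weight w (lead p) ≤ W') :
    Pi.single p f ∈ relsBelow k w lead Set.univ W' := by
  induction hf using Submodule.span_induction with
  | mem x hx =>
    obtain ⟨m, h1, h2, rfl⟩ := hx
    refine Submodule.subset_span ⟨m, p, trivial, ?_, rfl⟩
    rw [map_add]
    omega
  | zero => simp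
  | add x y _ _ hx hy => rw [Pi.single_add]; exact add_mem hx hy
  | smul a x _ hx => rw [Pi.single_smul]; exact Submodule.smul_mem _ _ hx

theorem monomial_smul_mem_sup {σ ι : Type*} [Fintype ι] [DecidableEq ι] {w : σ → ℕ}
    {lead : ι → σ →₀ ℕ} {N : Submodule (MvPolynomial σ k) (ι → MvPolynomial σ k)} {W : ℕ}
    (m : σ →₀ ℕ) {c : ι → MvPolynomial σ k}
    (hc : c ∈ N.restrictScalars k ⊔ relsBelow k w lead Set.univ W) :
    (monomial m 1 : MvPolynomial σ k) • c
      ∈ N.restrictScalars k ⊔ relsBelow k w lead Set.univ (Finsupp.weight w m + W) := by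
  obtain ⟨x, hx, y, hy, rfl⟩ := Submodule.mem_sup.1 hc
  rw [smul_add]
  exact Submodule.add_mem_sup (N.smul_mem _ hx) (monomial_smul_mem_relsBelow m hy)

section

variable {ε : k} {I : Ideal (MvPolynomial (Fin n × Fin n) k)}
  {N : Submodule (MvPolynomial (Fin n × Fin n) k)
    (QuadricIndex n → MvPolynomial (Fin n × Fin n) k)}

/-- After removing a common monomial factor `m₀`, the cofactors are the single variables `z` and
`y`, which is the case of a linear S-pair. -/
theorem sPair_of_common (hB : IsQuadraticBasis cellWeight leadExp (shafieiQuadric (n := n) ε) I)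
    (hN : ∀ c, HasCoeffDegree 1 c → evalRel (shafieiQuadric ε) c = 0 → c ∈ N)
    {p q : QuadricIndex n} {m m' : Fin n × Fin n →₀ ℕ} {x y z : Fin n × Fin n}
    (hp : leadExp p = Finsupp.single x 1 + Finsupp.single y 1)
    (hq : leadExp q = Finsupp.single x 1 + Finsupp.single z 1)
    (h : m + leadExp p = m' + leadExp q) :
    (Pi.single p (monomial m 1) - Pi.single q (monomial m' 1) :
      QuadricIndex n → MvPolynomial (Fin n × Fin n) k) ∈ N.restrictScalars k ⊔
      relsBelow k cellWeight leadExp Set.univ (Finsupp.weight cellWeight (m + leadExp p)) := by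
  classical
  by_cases hyz : y = z
  · subst hyz
    obtain rfl := leadExp_injective (hp.trans hq.symm)
    obtain rfl := add_right_cancel h
    rw [sub_self]
    exact zero_mem _
  · have h' : m + Finsupp.single y 1 = m' + Finsupp.single z 1 := by
      rw [hp, hq, add_comm (Finsupp.single x 1), ← add_assoc, add_comm (Finsupp.single x 1),
        ← add_assoc] at h
      exact add_right_cancel h
    have hz : Finsupp.single z 1 ≤ m := by
      rw [Finsupp.single_le_iff]
      have := DFunLike.congr_fun h' z
      simp only [Finsupp.add_apply, Finsupp.single_apply, hyz, if_true, if_false] at this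
      omega
    obtain ⟨m₀, rfl⟩ := exists_add_of_le hz
    obtain rfl : Finsupp.single y 1 + m₀ = m' := by
      refine add_left_cancel (a := Finsupp.single z 1) ?_
      rw [add_comm _ m', ← h']
      abel
    have key := hB.single_sub_single_mem hN (p := p) (q := q) (m := Finsupp.single z 1)
      (m' := Finsupp.single y 1) (Finsupp.degree_single _ _) (Finsupp.degree_single _ _)
      (by rw [hp, hq]; abel)
    have := monomial_smul_mem_sup m₀ key
    rwa [smul_sub, ← Pi.single_smul, ← Pi.single_smul, smul_eq_mul, smul_eq_mul, monomial_mul,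
      monomial_mul, one_mul, ← map_add, add_comm m₀ (Finsupp.single z 1),
      add_comm m₀ (Finsupp.single y 1), ← add_assoc, add_comm m₀ (Finsupp.single z 1)] at this

theorem exists_leadExp_eq {x y : Fin n × Fin n} (h : x ≤ y ∨ y ≤ x) :
    ∃ r : QuadricIndex n, leadExp r = Finsupp.single x 1 + Finsupp.single y 1 := by
  rcases h with h | h
  · exact ⟨(⟨(x.1, y.1), h.1⟩, ⟨(x.2, y.2), h.2⟩), rfl⟩
  · exact ⟨(⟨(y.1, x.1), h.1⟩, ⟨(y.2, x.2), h.2⟩), add_comm _ _⟩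

/-- Chain criterion: `x` and `x'` are comparable, so their product is itself a leading monomial, of
some `r`, and it divides the common multiple. The S-pair splits into those of `p, r` and of `r, q`,
each with a shared variable. -/
theorem sPair_of_comparable
    (hB : IsQuadraticBasis cellWeight leadExp (shafieiQuadric (n := n) ε) I)
    (hN : ∀ c, HasCoeffDegree 1 c → evalRel (shafieiQuadric ε) c = 0 → c ∈ N)
    {p q : QuadricIndex n} {m m' : Fin n × Fin n →₀ ℕ} {x y x' y' : Fin n × Fin n}
    (hp : leadExp p = Finsupp.single x 1 + Finsupp.single y 1)
    (hq : leadExp q = Finsupp.single x' 1 + Finsupp.single y' 1)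
    (hxx' : x ≠ x') (hle : x ≤ x' ∨ x' ≤ x) (h : m + leadExp p = m' + leadExp q) :
    (Pi.single p (monomial m 1) - Pi.single q (monomial m' 1) :
      QuadricIndex n → MvPolynomial (Fin n × Fin n) k) ∈ N.restrictScalars k ⊔
      relsBelow k cellWeight leadExp Set.univ (Finsupp.weight cellWeight (m + leadExp p)) := by
  obtain ⟨r, hr⟩ := exists_leadExp_eq hle
  have hrz : leadExp r ≤ m + leadExp p := by
    rw [hr]
    refine single_add_single_le ?_ ?_ hxx'
    · simp [hp]
    · rw [h]
      simp [hq]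
  obtain ⟨m₁, hm₁⟩ := exists_add_of_le hrz
  rw [add_comm (leadExp r)] at hm₁
  rw [← sub_add_sub_cancel _ (Pi.single r (monomial m₁ 1))]
  refine add_mem (sPair_of_common hB hN hp hr hm₁) ?_
  rw [hm₁]
  exact sPair_of_common hB hN (hr.trans (add_comm _ _)) hq (hm₁.symm.trans h)

theorem relationModule_le_of_koszulRel_mem (hε : ε * ε = 1)
    (hB : IsQuadraticBasis cellWeight leadExp (shafieiQuadric (n := n) ε) I)
    (hle : N ≤ relationModule (shafieiQuadric ε))
    (hN : ∀ c, HasCoeffDegree 1 c → evalRel (shafieiQuadric ε) c = 0 → c ∈ N)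
    (hK : ∀ b i l v, i ≠ l → Function.Injective v → koszulRel ε b i l v ∈ N) :
    relationModule (shafieiQuadric ε) ≤ N := by
  classical
  refine hB.relationModule_le hle fun p q m m' h => ?_
  set u : Fin n × Fin n := (p.1.1.1, p.2.1.1) with hu
  set v : Fin n × Fin n := (p.1.1.2, p.2.1.2) with hv
  set a : Fin n × Fin n := (q.1.1.1, q.2.1.1) with ha
  set b : Fin n × Fin n := (q.1.1.2, q.2.1.2) with hb
  have hp : leadExp p = Finsupp.single u 1 + Finsupp.single v 1 := rfl
  have hp' : leadExp p = Finsupp.single v 1 + Finsupp.single u 1 := hp.trans (add_comm _ _)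
  have hq : leadExp q = Finsupp.single a 1 + Finsupp.single b 1 := rfl
  have hq' : leadExp q = Finsupp.single b 1 + Finsupp.single a 1 := hq.trans (add_comm _ _)
  by_cases hua : u = a
  · exact sPair_of_common hB hN hp (hua ▸ hq) h
  by_cases hub : u = b
  · exact sPair_of_common hB hN hp (hub ▸ hq') h
  by_cases hva : v = a
  · exact sPair_of_common hB hN hp' (hva ▸ hq) h
  by_cases hvb : v = b
  · exact sPair_of_common hB hN hp' (hvb ▸ hq') h
  by_cases cua : u ≤ a ∨ a ≤ u
  · exact sPair_of_comparable hB hN hp hq hua cua h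
  by_cases cub : u ≤ b ∨ b ≤ u
  · exact sPair_of_comparable hB hN hp hq' hub cub h
  by_cases cva : v ≤ a ∨ a ≤ v
  · exact sPair_of_comparable hB hN hp' hq hva cva h
  by_cases cvb : v ≤ b ∨ b ≤ v
  · exact sPair_of_comparable hB hN hp' hq' hvb cvb h
  -- All four cross pairs of cells are now incomparable. Hence `p` and `q` share no row and no
  -- column, and their leading monomials are coprime.
  have hne : ∀ {s t : Fin n × Fin n}, ¬ (s ≤ t ∨ t ≤ s) → s.1 ≠ t.1 ∧ s.2 ≠ t.2 := by
    intro s t hst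
    rw [not_or, Prod.le_def, Prod.le_def] at hst
    constructor
    · intro e
      rcases le_total s.2 t.2 with h | h
      · exact hst.1 ⟨e.le, h⟩
      · exact hst.2 ⟨e.ge, h⟩
    · intro e
      rcases le_total s.1 t.1 with h | h
      · exact hst.1 ⟨h, e.le⟩
      · exact hst.2 ⟨h, e.ge⟩
  have hle : leadExp q ≤ m := by
    intro c
    have h1 := DFunLike.congr_fun h c
    rw [Finsupp.add_apply, Finsupp.add_apply, hp, hq] at h1
    rw [hq]
    simp only [Finsupp.add_apply, Finsupp.single_apply] at h1 ⊢
    by_cases hac : a = c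
    · subst hac
      simp only [hua, hva, reduceIte] at h1 ⊢
      omega
    · by_cases hbc : b = c
      · subst hbc
        simp only [hub, hvb, reduceIte] at h1 ⊢
        omega
      · simp [hac, hbc]
  obtain ⟨m₀, rfl⟩ := exists_add_of_le hle
  obtain rfl : leadExp p + m₀ = m' := by
    refine add_left_cancel (a := leadExp q) ?_
    rw [add_comm _ m', ← h]
    abel
  have hmem := (Submodule.Quotient.eq N).1 (shafieiQuadric_smul_single_mem hε hN hK
    (p := q) (q := p) (hne cua).1.symm (hne cva).1.symm (hne cub).1.symm (hne cvb).1.symm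
    (hne cua).2.symm (hne cva).2.symm (hne cub).2.symm (hne cvb).2.symm)
  -- The S-pair differs from the Koszul relation only by the tails of the two quadrics, which have
  -- lower weight.
  have key : (Pi.single p (monomial (leadExp q) 1) - Pi.single q (monomial (leadExp p) 1) :
      QuadricIndex n → MvPolynomial (Fin n × Fin n) k) ∈ N.restrictScalars k ⊔
      relsBelow k cellWeight leadExp Set.univ
        (Finsupp.weight cellWeight (leadExp q + leadExp p)) := by
    have e1 := single_mem_relsBelow (lead := leadExp) (hB.tail_mem q) p le_rfl
    have e2 := single_mem_relsBelow (lead := leadExp) (hB.tail_mem p) q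
      (add_comm (Finsupp.weight cellWeight (leadExp p)) _).le
    rw [← map_add] at e1 e2
    rw [← Pi.single_smul, ← Pi.single_smul, smul_eq_mul, smul_eq_mul, mul_one, mul_one] at hmem
    have := Submodule.add_mem_sup (S := N.restrictScalars k) hmem (sub_mem e2 e1)
    convert this using 1
    rw [Pi.single_sub, Pi.single_sub]
    abel
  have := monomial_smul_mem_sup m₀ key
  rwa [smul_sub, ← Pi.single_smul, ← Pi.single_smul, smul_eq_mul, smul_eq_mul, monomial_mul,
    monomial_mul, one_mul, ← map_add, add_comm m₀ (leadExp q), add_comm m₀ (leadExp p),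
    ← add_assoc, add_comm m₀ (leadExp q)] at this

/-- The linear relations of the quadrics. -/
def linearRels (ε : k) (n : ℕ) :
    Submodule k (QuadricIndex n → MvPolynomial (Fin n × Fin n) k) where
  carrier := {c | HasCoeffDegree 1 c ∧ evalRel (shafieiQuadric ε) c = 0}
  zero_mem' := ⟨fun _ => isHomogeneous_zero _ _ _, map_zero _⟩
  add_mem' h h' := ⟨h.1.add h'.1, by rw [map_add, h.2, h'.2, add_zero]⟩
  smul_mem' a _ h := ⟨fun p => (homogeneousSubmodule _ k 1).smul_mem a (h.1 p),
    by rw [map_smul, h.2, smul_zero]⟩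

theorem mkQ_koszulRel (b : Bool) (i l : Fin n) (v : Fin 4 → Fin n) :
    N.mkQ (koszulRel ε b i l v) = LinearRelations.rowDefect (cellVar k n b)
      (fun i i' j j' => N.mkQ (flipSymbol ε b i i' j j')) i l (v 0) (v 1) (v 2) (v 3) := rfl

theorem evalRel_koszulRel (ε : k) (b : Bool) (i l : Fin n) (v : Fin 4 → Fin n) :
    evalRel (shafieiQuadric ε) (koszulRel ε b i l v) = 0 := by
  rw [koszulRel, LinearRelations.rowDefect, map_sub, evalRel_smul, evalRel_smul,
    evalRel_flipSymbol_row, evalRel_flipSymbol_row]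
  ring

theorem hasCoeffDegree_koszulRel (ε : k) (b : Bool) (i l : Fin n) (v : Fin 4 → Fin n) :
    HasCoeffDegree 2 (koszulRel ε b i l v) :=
  HasCoeffDegree.sub
    (HasCoeffDegree.smul (d := 0) ((isHomogeneous_cellVar b _ _).mul (isHomogeneous_cellVar b _ _))
      (hasCoeffDegree_flipSymbol _ _ _ _ _ _))
    (HasCoeffDegree.smul (d := 0) ((isHomogeneous_cellVar b _ _).mul (isHomogeneous_cellVar b _ _))
      (hasCoeffDegree_flipSymbol _ _ _ _ _ _))

theorem relationModule_detQuadric (h2 : (2 : k) ≠ 0) :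
    Submodule.span (MvPolynomial (Fin n × Fin n) k) (linearRels (1 : k) n : Set (QuadricIndex n → MvPolynomial (Fin n × Fin n) k)) = relationModule (shafieiQuadric (1 : k)) := by
  have hle : Submodule.span (MvPolynomial (Fin n × Fin n) k) (linearRels (1 : k) n : Set (QuadricIndex n → MvPolynomial (Fin n × Fin n) k)) ≤
      relationModule (shafieiQuadric (1 : k)) := Submodule.span_le.2 fun c hc => hc.2
  have hN : ∀ c, HasCoeffDegree 1 c → evalRel (shafieiQuadric (1 : k)) c = 0 →
      c ∈ Submodule.span (MvPolynomial (Fin n × Fin n) k) (linearRels (1 : k) n : Set (QuadricIndex n → MvPolynomial (Fin n × Fin n) k)) :=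
    fun c h h' => Submodule.subset_span ⟨h, h'⟩
  refine le_antisymm hle (relationModule_le_of_koszulRel_mem (one_mul 1)
    isQuadraticBasis_detQuadric hle hN fun b i l v hil hv => ?_)
  have hL := linearRelations_flipSymbol (one_mul 1) b hN
  rw [C_1] at hL
  have := hL.two_smul_rowDefect hil (hv.ne (show (0 : Fin 4) ≠ 2 by decide))
    (hv.ne (show (1 : Fin 4) ≠ 2 by decide)) (hv.ne (show (0 : Fin 4) ≠ 1 by decide)) (d := v 3)
  rw [← mkQ_koszulRel] at this
  have h3 := congrArg (fun y => (C (2⁻¹ : k) : MvPolynomial (Fin n × Fin n) k) • y) this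
  simp only [smul_zero, smul_smul] at h3
  rw [show (2 : MvPolynomial (Fin n × Fin n) k) = C 2 from (map_ofNat C 2).symm, ← C_mul, inv_mul_cancel₀ h2, C_1,
    one_smul] at h3
  exact (Submodule.Quotient.mk_eq_zero _).1 h3

/-- The index set of the quadratic relations: the choice of rows or columns, two of them, and
four of the others. -/
abbrev KoszulIndex (n : ℕ) : Type :=
  Bool × {s : Finset (Fin n) // s.card = 2} × {t : Finset (Fin n) // t.card = 4}

/-- The quadratic relation with a given index. -/
def quadraticRel (k : Type*) [Field k] (n : ℕ) (a : KoszulIndex n) :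
    QuadricIndex n → MvPolynomial (Fin n × Fin n) k :=
  koszulRel (-1) a.1 (a.2.1.1.orderEmbOfFin a.2.1.2 0) (a.2.1.1.orderEmbOfFin a.2.1.2 1)
    (a.2.2.1.orderEmbOfFin a.2.2.2)

theorem exists_perm_orderEmbOfFin {v : Fin 4 → Fin n} (hv : Function.Injective v) :
    ∃ (t : {t : Finset (Fin n) // t.card = 4}) (s : Equiv.Perm (Fin 4)),
      ∀ p, t.1.orderEmbOfFin t.2 (s p) = v p := by
  classical
  have ht : (Finset.univ.image v).card = 4 := by simp [Finset.card_image_of_injective _ hv]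
  have hex : ∀ p, ∃ q, (Finset.univ.image v).orderEmbOfFin ht q = v p := by
    intro p
    have : v p ∈ Set.range ((Finset.univ.image v).orderEmbOfFin ht) := by
      rw [Finset.range_orderEmbOfFin]
      simp
    exact this
  choose s hs using hex
  have hinj : Function.Injective s := fun p q h => hv (by rw [← hs p, ← hs q, h])
  exact ⟨⟨_, ht⟩, Equiv.ofBijective s (Finite.injective_iff_bijective.1 hinj), hs⟩

theorem exists_orderEmbOfFin_pair {i l : Fin n} (h : i < l) :
    ∃ s : {s : Finset (Fin n) // s.card = 2}, s.1.orderEmbOfFin s.2 0 = i ∧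
      s.1.orderEmbOfFin s.2 1 = l := by
  classical
  have hs : ({i, l} : Finset (Fin n)).card = 2 := Finset.card_pair h.ne
  have := Finset.orderEmbOfFin_unique hs (f := ![i, l]) (by intro x; fin_cases x <;> simp)
    (by intro x y hxy; fin_cases x <;> fin_cases y <;> simp_all)
  exact ⟨⟨_, hs⟩, (congrFun this 0).symm, (congrFun this 1).symm⟩

theorem koszulRel_mem_of_quadraticRel_mem
    (hN : ∀ c, HasCoeffDegree 1 c → evalRel (shafieiQuadric (-1 : k)) c = 0 → c ∈ N)
    (hq : ∀ a, quadraticRel k n a ∈ N) (b : Bool) {i l : Fin n} {v : Fin 4 → Fin n} (hil : i ≠ l)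
    (hv : Function.Injective v) : koszulRel (-1) b i l v ∈ N := by
  have key : ∀ (i l : Fin n) (v : Fin 4 → Fin n), i < l → Function.Injective v →
      koszulRel (-1) b i l v ∈ N := by
    intro i l v hil hv
    obtain ⟨s, rfl, rfl⟩ := exists_orderEmbOfFin_pair hil
    obtain ⟨t, p, ht⟩ := exists_perm_orderEmbOfFin hv
    have hL := linearRelations_flipSymbol (by ring : (-1 : k) * -1 = 1) b hN
    rw [C_neg, C_1] at hL
    rw [← Submodule.Quotient.mk_eq_zero, ← Submodule.mkQ_apply, mkQ_koszulRel, ← ht, ← ht, ← ht,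
      ← ht, hL.rowDefect_comp_perm hil.ne p (t.1.orderEmbOfFin t.2).injective]
    exact (Submodule.Quotient.mk_eq_zero N).2 (hq (b, s, t))
  rcases lt_or_gt_of_ne hil with h | h
  · exact key i l v h hv
  -- Interchanging the two rows along with their pairs of columns negates the Koszul relation.
  · have := key l i ![v 2, v 3, v 0, v 1] h ?_
    · have := N.neg_mem this
      rwa [koszulRel, LinearRelations.rowDefect, neg_sub] at this
    · intro x y hxy
      have : v (![2, 3, 0, 1] x) = v (![2, 3, 0, 1] y) := by
        fin_cases x <;> fin_cases y <;> simp_all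
      have := hv this
      fin_cases x <;> fin_cases y <;> simp_all

theorem relationModule_permQuadric :
    Submodule.span (MvPolynomial (Fin n × Fin n) k) ((linearRels (-1 : k) n : Set (QuadricIndex n → MvPolynomial (Fin n × Fin n) k)) ∪ Set.range (quadraticRel k n))
      = relationModule (shafieiQuadric (-1 : k)) := by
  have hle : Submodule.span (MvPolynomial (Fin n × Fin n) k) ((linearRels (-1 : k) n : Set (QuadricIndex n → MvPolynomial (Fin n × Fin n) k)) ∪ Set.range (quadraticRel k n)) ≤
      relationModule (shafieiQuadric (-1 : k)) := by
    refine Submodule.span_le.2 ?_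
    rintro c (hc | ⟨a, rfl⟩)
    · exact hc.2
    · exact evalRel_koszulRel ..
  have hN : ∀ c, HasCoeffDegree 1 c → evalRel (shafieiQuadric (-1 : k)) c = 0 →
      c ∈ Submodule.span (MvPolynomial (Fin n × Fin n) k)
        ((linearRels (-1 : k) n : Set (QuadricIndex n → MvPolynomial (Fin n × Fin n) k)) ∪ Set.range (quadraticRel k n)) :=
    fun c h h' => Submodule.subset_span (Or.inl ⟨h, h'⟩)
  exact le_antisymm hle (relationModule_le_of_koszulRel_mem (by ring)
    isQuadraticBasis_permQuadric hle hN fun b i l v hil hv => koszulRel_mem_of_quadraticRel_mem hN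
      (fun a => Submodule.subset_span (Or.inr ⟨a, rfl⟩)) b hil hv)

end

end SPairs

/-! ### Minimality from constant terms and degrees. -/

section Minimality

variable {k : Type*} [Field k]

theorem coeff_mul_of_isHomogeneous {σ : Type*} {f g : MvPolynomial σ k} {d : ℕ}
    (hg : g.IsHomogeneous d) {e : σ →₀ ℕ} (he : e.degree ≤ d) :
    coeff e (f * g) = coeff 0 f * coeff e g := by
  classical
  rw [coeff_mul, Finset.sum_eq_single (0, e)]
  · rintro ⟨a, b⟩ hab hne
    replace hab : a + b = e := by simpa using hab
    refine mul_eq_zero_of_right _ (hg.coeff_eq_zero fun hb => hne ?_)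
    have ha : a.degree = 0 := by
      have := congrArg Finsupp.degree hab
      replace hb : b.degree = d := hb
      simp only [map_add] at this
      omega
    rw [Finsupp.degree_eq_zero_iff] at ha
    subst ha
    rw [zero_add] at hab
    rw [hab]
  · intro h
    simp at h

/-- A generating family is minimal if the coefficients of all its relations have no constant
term. -/
theorem isMinimalGeneratingFamily_of_coeff {σ κ F : Type*} [Fintype κ] [AddCommGroup F]
    [Module (MvPolynomial σ k) F] {N : Submodule (MvPolynomial σ k) F} {r : κ → F}
    (hr : Submodule.span (MvPolynomial σ k) (Set.range r) = N)
    (h : ∀ c : κ → MvPolynomial σ k, ∑ a, c a • r a = 0 → ∀ a, coeff 0 (c a) = 0) :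
    IsMinimalGeneratingFamily N r := by
  classical
  refine ⟨hr, fun s hs => Set.eq_univ_of_forall fun a => ?_⟩
  by_contra ha
  have hmem : r a ∈ Submodule.span (MvPolynomial σ k) (r '' s) := by
    rw [hs, ← hr]
    exact Submodule.subset_span ⟨a, rfl⟩
  obtain ⟨c, hc, hca⟩ := (Finsupp.mem_span_image_iff_linearCombination _).1 hmem
  have hca' : ∑ b, c b • r b = r a := by
    rw [← hca, Finsupp.linearCombination_apply, Finsupp.sum_fintype]
    simp
  have h0 := h (Pi.single a 1 - ⇑c) (by
    simp only [Pi.sub_apply, sub_smul, Finset.sum_sub_distrib, hca']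
    rw [Finset.sum_eq_single a]
    · simp
    · intro b _ hb
      simp [hb]
    · simp) a
  rw [Pi.sub_apply, Pi.single_eq_same, (Finsupp.mem_supported' _ c).1 hc a ha, sub_zero,
    coeff_zero_one] at h0
  exact one_ne_zero h0

variable {n : ℕ}

theorem isHomogeneous_shafieiQuadric (ε : k) (p : QuadricIndex n) :
    (shafieiQuadric ε p).IsHomogeneous 2 := by
  simp only [shafieiQuadric]
  split_ifs
  · exact ((isHomogeneous_X _ _).mul (isHomogeneous_X _ _)).add
      ((homogeneousSubmodule _ k 2).smul_mem ε ((isHomogeneous_X _ _).mul (isHomogeneous_X _ _)))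
  · exact (isHomogeneous_X _ _).mul (isHomogeneous_X _ _)

/-- The tail of a binomial quadric is a strictly antidiagonal product, which is never a leading
monomial. -/
theorem coeff_leadExp_shafieiQuadric (ε : k) (p q : QuadricIndex n) :
    coeff (leadExp q) (shafieiQuadric ε p) = if p = q then 1 else 0 := by
  classical
  have h1 : coeff (leadExp q) (monomial (leadExp p) (1 : k)) = if p = q then 1 else 0 := by
    rw [coeff_monomial]
    simp only [leadExp_injective.eq_iff]
  rw [← h1]
  obtain ⟨⟨⟨i, i'⟩, hi⟩, ⟨⟨j, j'⟩, hj⟩⟩ := p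
  obtain ⟨⟨⟨l, l'⟩, hl⟩, ⟨⟨m, m'⟩, hm⟩⟩ := q
  simp only at hi hj hl hm
  simp only [shafieiQuadric]
  split_ifs with h
  · rw [X_mul_X_eq_monomial, X_mul_X_eq_monomial, coeff_add, coeff_smul, leadExp]
    refine add_eq_left.2 ?_
    rw [coeff_monomial, if_neg, smul_zero]
    simp only [Finsupp.single_add_single_eq_single_add_single one_ne_zero one_ne_zero,
      Prod.mk.injEq]
    rintro (⟨⟨rfl, rfl⟩, rfl, rfl⟩ | ⟨-, ⟨rfl, rfl⟩, rfl, rfl⟩ | ⟨h, -⟩)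
    · exact h.2.not_ge hm
    · exact h.1.not_ge hl
    · omega
  · rw [X_mul_X_eq_monomial]
    rfl

theorem isMinimalGeneratingFamily_shafieiQuadric {ε : k}
    {I : Ideal (MvPolynomial (Fin n × Fin n) k)}
    (hB : IsQuadraticBasis cellWeight leadExp (shafieiQuadric (n := n) ε) I) :
    IsMinimalGeneratingFamily I (shafieiQuadric (n := n) ε) := by
  refine isMinimalGeneratingFamily_of_coeff hB.span_range fun c hc q => ?_
  have := congrArg (coeff (leadExp q)) hc
  rw [coeff_sum, coeff_zero] at this
  simp only [smul_eq_mul, coeff_mul_of_isHomogeneous (isHomogeneous_shafieiQuadric ε _)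
    (hB.degree_lead q).le, coeff_leadExp_shafieiQuadric] at this
  simpa using this

/-- In degree `d` only the constant terms of the coefficients `c a` contribute. The summand `x`
leaves room for relations of higher degree. -/
theorem sum_coeff_smul_eq_zero {σ ι κ : Type*} [Fintype κ] {d : ℕ}
    {l : κ → ι → MvPolynomial σ k} (hl : ∀ a, HasCoeffDegree d (l a))
    {c : κ → MvPolynomial σ k} {x : ι → MvPolynomial σ k} (h : ∑ a, c a • l a + x = 0)
    (hx : ∀ p e, e.degree ≤ d → coeff e (x p) = 0) : ∑ a, coeff 0 (c a) • l a = 0 := by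
  ext p e
  have h0 := congrArg (coeff e) (congrFun h p)
  simp only [Finset.sum_apply, Pi.smul_apply, coeff_sum, coeff_smul, Pi.add_apply, coeff_add,
    smul_eq_mul, Pi.zero_apply, coeff_zero] at h0 ⊢
  by_cases he : e.degree = d
  · rw [hx p e he.le, add_zero] at h0
    simpa only [coeff_mul_of_isHomogeneous (hl _ p) he.le] using h0
  · exact Finset.sum_eq_zero fun a _ => by rw [(hl a p).coeff_eq_zero he, mul_zero]

/-- A `k`-basis of the linear relations generates the module of relations minimally if it
generates it. -/
theorem isMinimalGeneratingFamily_of_linearIndependent {σ ι κ : Type*} [Fintype κ]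
    {N : Submodule (MvPolynomial σ k) (ι → MvPolynomial σ k)} {l : κ → ι → MvPolynomial σ k}
    {d : ℕ} (hl : ∀ a, HasCoeffDegree d (l a)) (hli : LinearIndependent k l)
    (hspan : Submodule.span (MvPolynomial σ k) (Set.range l) = N) :
    IsMinimalGeneratingFamily N l :=
  isMinimalGeneratingFamily_of_coeff hspan fun c hc =>
    Fintype.linearIndependent_iff.1 hli _
      (sum_coeff_smul_eq_zero hl (x := 0) (by rw [hc, add_zero]) (by simp))

end Minimality

/-! ### A functional separating the quadratic relations of the permanent from the linear ones. -/

section QuadraticFunctional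

variable {k : Type*} [Field k] {n : ℕ}

/-- The row (or the column, if `b` is true) of a cell. -/
def cellRow (b : Bool) (u : Fin n × Fin n) : Fin n := if b then u.2 else u.1

/-- The column (or the row, if `b` is true) of a cell. -/
def cellCol (b : Bool) (u : Fin n × Fin n) : Fin n := if b then u.1 else u.2

/-- The pair of rows (or of columns, if `b` is true) of a quadric. -/
def rowPair (b : Bool) (p : QuadricIndex n) : Fin n × Fin n := if b then p.2.1 else p.1.1

/-- The pair of columns (or of rows, if `b` is true) of a quadric. -/
def colPair (b : Bool) (p : QuadricIndex n) : Fin n × Fin n := if b then p.1.1 else p.2.1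

/-- The substitution which keeps the variables of the row `l` and kills the others. -/
def rowSubst (k : Type*) [Field k] (b : Bool) (l : Fin n) :
    MvPolynomial (Fin n × Fin n) k →ₐ[k] MvPolynomial (Fin n) k :=
  aeval fun u => if cellRow b u = l then X (cellCol b u) else 0

/-- The substitution `X_{r,c} ↦ ρ_r y_c` of a matrix of rank one, where `ρ_i = 1`, `ρ_l = t` and
the other `ρ_r` are zero. -/
def rankOneSubst (k : Type*) [Field k] (b : Bool) (i l : Fin n) :
    MvPolynomial (Fin n × Fin n) k →ₐ[k] Polynomial (MvPolynomial (Fin n) k) :=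
  aeval fun u => (if cellRow b u = i then 1 else if cellRow b u = l then Polynomial.X else 0) *
    Polynomial.C (X (cellCol b u))

/-- The linear form on relations which reads off the quadrics in the row `i` and the coefficients
in the row `l`. -/
def relForm (b : Bool) (i l : Fin n)
    (c : QuadricIndex n → MvPolynomial (Fin n × Fin n) k) : MvPolynomial (Fin n) k :=
  ∑ p, rowSubst k b l (c p) *
    if rowPair b p = (i, i) then X (colPair b p).1 * X (colPair b p).2 else 0

theorem relForm_add (b : Bool) (i l : Fin n)
    (c c' : QuadricIndex n → MvPolynomial (Fin n × Fin n) k) :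
    relForm b i l (c + c') = relForm b i l c + relForm b i l c' := by
  simp only [relForm, Pi.add_apply, map_add, add_mul, Finset.sum_add_distrib]

theorem relForm_smul (b : Bool) (i l : Fin n) (f : MvPolynomial (Fin n × Fin n) k)
    (c : QuadricIndex n → MvPolynomial (Fin n × Fin n) k) :
    relForm b i l (f • c) = rowSubst k b l f * relForm b i l c := by
  simp only [relForm, Pi.smul_apply, smul_eq_mul, map_mul, mul_assoc, Finset.mul_sum]

theorem relForm_sub (b : Bool) (i l : Fin n)
    (c c' : QuadricIndex n → MvPolynomial (Fin n × Fin n) k) :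
    relForm b i l (c - c') = relForm b i l c - relForm b i l c' := by
  simp only [relForm, Pi.sub_apply, map_sub, sub_mul, Finset.sum_sub_distrib]

theorem relForm_sum {κ : Type*} (s : Finset κ) (b : Bool) (i l : Fin n)
    (c : κ → QuadricIndex n → MvPolynomial (Fin n × Fin n) k) :
    relForm b i l (∑ a ∈ s, c a) = ∑ a ∈ s, relForm b i l (c a) := by
  simp only [relForm, Finset.sum_apply, map_sum, Finset.sum_mul]
  exact Finset.sum_comm

theorem relForm_single (b : Bool) (i l : Fin n) (p : QuadricIndex n)
    (f : MvPolynomial (Fin n × Fin n) k) :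
    relForm b i l (Pi.single p f) = rowSubst k b l f *
      if rowPair b p = (i, i) then X (colPair b p).1 * X (colPair b p).2 else 0 := by
  rw [relForm, Finset.sum_eq_single p]
  · simp
  · intro q _ hq
    simp [hq]
  · simp

theorem min_mul_max_X (a c : Fin n) :
    (X (min a c) * X (max a c) : MvPolynomial (Fin n) k) = X a * X c := by
  rcases le_total a c with h | h <;> simp [h, mul_comm]

theorem relForm_flipSymbol (ε : k) (b : Bool) (i l j a c : Fin n) :
    relForm b i l (flipSymbol ε b j j a c) = if j = i then X a * X c else 0 := by
  cases b <;>
    simp [flipSymbol, quadSymbol, relForm_single, rowPair, colPair, sortPair, min_mul_max_X]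

theorem relForm_flipSymbol_of_ne (ε : k) {b b' : Bool} (hb : b ≠ b') (i l j : Fin n)
    {a c : Fin n} (hac : a ≠ c) : relForm b i l (flipSymbol ε b' j j a c) = 0 := by
  have h : ∀ i, ¬ (min a c = i ∧ max a c = i) := by
    rintro i ⟨h1, h2⟩
    exact hac (inf_eq_sup.1 (h1.trans h2.symm))
  clear hac
  cases b <;> cases b' <;>
    simp_all [-not_and, flipSymbol, quadSymbol, relForm_single, rowPair, sortPair]

theorem rowSubst_cellVar (b : Bool) (l r c : Fin n) :
    rowSubst k b l (cellVar k n b r c) = if r = l then X c else 0 := by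
  cases b <;> simp [rowSubst, cellVar, cellRow, cellCol]

theorem coeff_zero_rowSubst (b : Bool) (l : Fin n) (f : MvPolynomial (Fin n × Fin n) k) :
    coeff 0 (rowSubst k b l f) = coeff 0 f := by
  have : (constantCoeff (R := k) (σ := Fin n)).comp (rowSubst k b l).toRingHom
      = constantCoeff (R := k) := by
    refine MvPolynomial.ringHom_ext (fun r => ?_) fun u => ?_
    · simp [rowSubst]
    · by_cases h : cellRow b u = l <;> simp [rowSubst, h]
  exact RingHom.congr_fun this f

theorem relForm_koszulRel (ε : k) (b : Bool) {i l i' l' : Fin n} (h : i < l) (h' : i' < l')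
    (v : Fin 4 → Fin n) : relForm b i l (koszulRel ε b i' l' v) =
      if i' = i ∧ l' = l then ∏ p, X (v p) else 0 := by
  rw [koszulRel, LinearRelations.rowDefect, relForm_sub, relForm_smul, relForm_smul,
    relForm_flipSymbol, relForm_flipSymbol, map_mul, map_mul]
  simp only [rowSubst_cellVar]
  -- The other half of the Koszul relation would contribute only with the two rows exchanged, which
  -- their order excludes.
  have h2 : ¬ (i' = l ∧ l' = i) := by
    rintro ⟨rfl, rfl⟩
    exact h.not_gt h'
  by_cases e1 : i' = i <;> by_cases e2 : l' = l <;> by_cases e3 : i' = l <;>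
    by_cases e4 : l' = i <;> simp_all [Fin.prod_univ_four]
  ring

theorem relForm_koszulRel_of_ne (ε : k) {b b' : Bool} (hb : b ≠ b') (i l i' l' : Fin n)
    {v : Fin 4 → Fin n} (hv : Function.Injective v) :
    relForm b i l (koszulRel ε b' i' l' v) = 0 := by
  rw [koszulRel, LinearRelations.rowDefect, relForm_sub, relForm_smul, relForm_smul,
    relForm_flipSymbol_of_ne ε hb _ _ _ (hv.ne (by decide)),
    relForm_flipSymbol_of_ne ε hb _ _ _ (hv.ne (by decide))]
  simp

/-- In a linear form only the variables of row `l` acquire the factor `t`. -/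
theorem coeff_one_rankOneSubst (b : Bool) {i l : Fin n} (hil : i ≠ l)
    {f : MvPolynomial (Fin n × Fin n) k} (hf : f.IsHomogeneous 1) :
    (rankOneSubst k b i l f).coeff 1 = rowSubst k b l f := by
  have hf' : f ∈ Submodule.span k (Set.range (X : Fin n × Fin n → MvPolynomial _ k)) := by
    rw [← homogeneousSubmodule_one_eq_span_X]
    exact hf
  clear hf
  induction hf' using Submodule.span_induction with
  | mem x hx =>
    obtain ⟨u, rfl⟩ := hx
    rw [rankOneSubst, rowSubst, aeval_X, aeval_X, Polynomial.coeff_mul_C]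
    by_cases h : cellRow b u = i
    · simp [h, hil, Polynomial.coeff_one]
    · by_cases h' : cellRow b u = l <;> simp [h, h', hil.symm]
  | zero => simp
  | add x y _ _ hx hy => rw [map_add, map_add, Polynomial.coeff_add, hx, hy]
  | smul a x _ hx => rw [map_smul, map_smul, Polynomial.coeff_smul, hx]

/-- For `ε = -1` the binomial quadrics are 2 × 2 minors, which vanish on a matrix of rank one; only
the monomial quadrics survive. -/
theorem rankOneSubst_shafieiQuadric (b : Bool) (i l : Fin n) (p : QuadricIndex n) :
    ∃ ρ : Fin n → Polynomial (MvPolynomial (Fin n) k),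
      ρ = (fun r => if r = i then 1 else if r = l then Polynomial.X else 0) ∧
      rankOneSubst k b i l (shafieiQuadric (-1) p) =
        if (rowPair b p).1 = (rowPair b p).2 ∨ (colPair b p).1 = (colPair b p).2 then
          ρ (rowPair b p).1 * ρ (rowPair b p).2 *
            Polynomial.C (X (colPair b p).1 * X (colPair b p).2)
        else 0 := by
  obtain ⟨ρ, hρ⟩ : ∃ ρ : Fin n → Polynomial (MvPolynomial (Fin n) k),
    ρ = fun r => if r = i then 1 else if r = l then Polynomial.X else 0 := ⟨_, rfl⟩
  refine ⟨ρ, hρ, ?_⟩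
  have hX : ∀ u, rankOneSubst k b i l (X u) = ρ (cellRow b u) * Polynomial.C (X (cellCol b u)) :=
    fun u => by rw [rankOneSubst, aeval_X, hρ]
  clear hρ
  obtain ⟨⟨⟨r, r'⟩, hr⟩, ⟨⟨c, c'⟩, hc⟩⟩ := p
  simp only at hr hc
  have h : (r < r' ∧ c < c') ↔ ¬ (r = r' ∨ c = c') := by
    rw [hr.lt_iff_ne, hc.lt_iff_ne, not_or]
  simp only [shafieiQuadric, h]
  by_cases h' : r = r' ∨ c = c'
  · have h'' : c = c' ∨ r = r' := h'.symm
    cases b <;> simp [h', h'', hX, rowPair, colPair, cellRow, cellCol] <;> ring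
  · have h'' : ¬ (c = c' ∨ r = r') := fun h => h' h.symm
    cases b <;> simp [h', h'', hX, rowPair, colPair, cellRow, cellCol] <;> ring

/-- The ideal generated by the squares of the variables. -/
def squareIdeal (k : Type*) [Field k] (n : ℕ) : Ideal (MvPolynomial (Fin n) k) :=
  Ideal.span (Set.range fun a => X a ^ 2)

theorem coeff_eq_zero_of_mem_squareIdeal {f : MvPolynomial (Fin n) k} (hf : f ∈ squareIdeal k n)
    {e : Fin n →₀ ℕ} (he : ∀ a, e a ≤ 1) : coeff e f = 0 := by
  have h : (Set.range fun a : Fin n => (X a ^ 2 : MvPolynomial (Fin n) k))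
      = (fun s => monomial s 1) '' Set.range fun a => Finsupp.single a 2 := by
    rw [← Set.range_comp]
    simp [Function.comp_def, X_pow_eq_monomial]
  rw [squareIdeal, h, mem_ideal_span_monomial_image] at hf
  by_contra hne
  obtain ⟨_, ⟨a, rfl⟩, ha⟩ := hf e (mem_support_iff.2 hne)
  have := Finsupp.single_le_iff.1 ha
  have := he a
  omega

/-- Take the coefficient of `t` in the relation after the rank-one substitution. Monomials in row
`i` give `relForm`, those in row `l` carry `t ^ 2` and give nothing, and those in a single column
`s` with distinct rows give multiples of `y_s ^ 2`. -/
theorem relForm_mem_squareIdeal (b : Bool) {i l : Fin n} (hil : i ≠ l)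
    {c : QuadricIndex n → MvPolynomial (Fin n × Fin n) k} (hc : c ∈ linearRels (-1) n) :
    relForm b i l c ∈ squareIdeal k n := by
  obtain ⟨hdeg, h0⟩ := hc
  have h1 := congrArg (fun f => (rankOneSubst k b i l f).coeff 1) h0
  simp only [evalRel_apply, map_sum, map_mul, Polynomial.finsetSum_coeff, map_zero,
    Polynomial.coeff_zero] at h1
  -- The vanishing coefficient of `t` stands in for zero, so the comparison with `relForm` can be
  -- made quadric by quadric.
  rw [← neg_mem_iff, ← zero_sub, ← h1, relForm, ← Finset.sum_sub_distrib]
  refine Ideal.sum_mem _ fun p _ => ?_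
  obtain ⟨ρ, hρ, hp⟩ := rankOneSubst_shafieiQuadric (k := k) b i l p
  rw [hp, ← coeff_one_rankOneSubst b hil (hdeg p)]
  generalize rankOneSubst k b i l (c p) = f
  obtain ⟨r, r'⟩ := rowPair b p
  obtain ⟨s, s'⟩ := colPair b p
  simp only [Prod.mk.injEq]
  by_cases hrr : r = r'
  · subst hrr
    rw [if_pos (Or.inl rfl), ← mul_assoc, Polynomial.coeff_mul_C]
    by_cases hri : r = i
    · simp [hρ, hri]
    · by_cases hrl : r = l
      · subst hrl
        simp [hρ, hri, ← mul_assoc, Polynomial.coeff_mul_X]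
      · simp [hρ, hri, hrl]
  · rw [if_neg (c := r = i ∧ r' = i) fun h => hrr (h.1.trans h.2.symm), mul_zero, sub_zero]
    by_cases hss : s = s'
    · subst hss
      rw [if_pos (Or.inr rfl), ← mul_assoc, Polynomial.coeff_mul_C, ← pow_two]
      exact Ideal.mul_mem_left _ _ (Ideal.subset_span ⟨s, rfl⟩)
    · rw [if_neg (by simp [hrr, hss])]
      simp

end QuadraticFunctional

/-! ### Minimal generation of the relations of the permanent quadrics. -/

section PermanentRelations

variable {k : Type*} [Field k] {n : ℕ}

/-- The exponent of the squarefree monomial `∏ j ∈ t, y_j`. -/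
def setExp (t : Finset (Fin n)) : Fin n →₀ ℕ := ∑ j ∈ t, Finsupp.single j 1

theorem setExp_apply (t : Finset (Fin n)) (j : Fin n) : setExp t j = if j ∈ t then 1 else 0 := by
  classical
  simp [setExp, Finsupp.finsetSum_apply, Finsupp.single_apply]

theorem setExp_injective : Function.Injective (setExp (n := n)) := by
  intro s t h
  ext j
  have := DFunLike.congr_fun h j
  rw [setExp_apply, setExp_apply] at this
  split_ifs at this <;> simp_all

theorem degree_setExp (t : Finset (Fin n)) : (setExp t).degree = t.card := by
  simp [setExp, Finsupp.degree_single]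

theorem prod_X_orderEmbOfFin {d : ℕ} {t : Finset (Fin n)} (ht : t.card = d) :
    ∏ p, X (t.orderEmbOfFin ht p) = (monomial (setExp t) 1 : MvPolynomial (Fin n) k) := by
  conv_rhs => rw [setExp, monomial_sum_one, ← Finset.map_orderEmbOfFin_univ t ht, Finset.prod_map]
  rfl

theorem relForm_quadraticRel (a a' : KoszulIndex n) :
    relForm a.1 (a.2.1.1.orderEmbOfFin a.2.1.2 0) (a.2.1.1.orderEmbOfFin a.2.1.2 1)
      (quadraticRel k n a') =
      if a'.1 = a.1 ∧ a'.2.1 = a.2.1 then monomial (setExp a'.2.2.1) 1 else 0 := by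
  classical
  obtain ⟨b, ⟨s, hs⟩, t⟩ := a
  obtain ⟨b', ⟨s', hs'⟩, ⟨t', ht'⟩⟩ := a'
  simp only [quadraticRel, Subtype.mk.injEq]
  by_cases hb : b' = b
  · subst hb
    rw [relForm_koszulRel _ _ ((s.orderEmbOfFin hs).strictMono (by decide))
      ((s'.orderEmbOfFin hs').strictMono (by decide)), prod_X_orderEmbOfFin]
    congr 1
    simp only [true_and, eq_iff_iff]
    constructor
    · rintro ⟨h0, h1⟩
      rw [← Finset.image_orderEmbOfFin_univ s hs, ← Finset.image_orderEmbOfFin_univ s' hs']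
      refine Finset.image_congr fun p _ => ?_
      fin_cases p
      · exact h0
      · exact h1
    · rintro rfl
      exact ⟨rfl, rfl⟩
  · rw [relForm_koszulRel_of_ne _ (Ne.symm hb) _ _ _ _ (t'.orderEmbOfFin ht').injective,
      if_neg fun h => hb h.1]

theorem isMinimalGeneratingFamily_permQuadric {κ κ' : Type*} [Fintype κ] [Fintype κ']
    {l : κ → QuadricIndex n → MvPolynomial (Fin n × Fin n) k} (hl : LinearIndependent k l)
    (hspan : Submodule.span k (Set.range l) = linearRels (-1) n) (e : κ' ≃ KoszulIndex n) :
    IsMinimalGeneratingFamily (relationModule (permQuadric k n))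
      (Sum.elim l (quadraticRel k n ∘ e)) := by
  classical
  have hmem : ∀ a, l a ∈ linearRels (-1 : k) n := fun a => by
    rw [← hspan]
    exact Submodule.subset_span ⟨a, rfl⟩
  refine isMinimalGeneratingFamily_of_coeff ?_ fun c hc => ?_
  · rw [Set.Sum.elim_range, EquivLike.range_comp, permQuadric, ← relationModule_permQuadric]
    refine le_antisymm (Submodule.span_mono (Set.union_subset_union_left _ ?_))
      (Submodule.span_le.2 (Set.union_subset ?_ ?_))
    · rintro _ ⟨a, rfl⟩
      exact hmem a
    · intro x hx
      rw [SetLike.mem_coe, ← hspan] at hx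
      exact Submodule.span_subset_span k _ _
        (Submodule.span_mono Set.subset_union_left hx)
    · exact Set.subset_union_right.trans Submodule.subset_span
  · rw [Fintype.sum_sum_type] at hc
    simp only [Sum.elim_inl, Sum.elim_inr, Function.comp_apply] at hc
    have hq : ∀ a, HasCoeffDegree 2 (quadraticRel k n a) := fun a =>
      hasCoeffDegree_koszulRel _ _ _ _ _
    rintro (a | b)
    -- The quadratic relations have no terms of degree at most 1, so the degree 1 part is a scalar
    -- dependence among the `l a`.
    · refine Fintype.linearIndependent_iff.1 hl (fun a => coeff 0 (c (Sum.inl a)))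
        (sum_coeff_smul_eq_zero (fun a => (hmem a).1) hc fun p x hx => ?_) a
      rw [Finset.sum_apply, coeff_sum]
      refine Finset.sum_eq_zero fun b _ => ?_
      rw [Pi.smul_apply, smul_eq_mul, coeff_mul_of_isHomogeneous (hq (e b) p) (by omega),
        (hq (e b) p).coeff_eq_zero (by omega), mul_zero]
    · obtain ⟨a, ha⟩ : ∃ a, a = e b := ⟨_, rfl⟩
      have hil : a.2.1.1.orderEmbOfFin a.2.1.2 0 ≠ a.2.1.1.orderEmbOfFin a.2.1.2 1 :=
        (a.2.1.1.orderEmbOfFin a.2.1.2).injective.ne (by decide)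
      -- Apply `relForm` for the two rows of this relation and read the squarefree monomial of its
      -- four columns. Linear relations contribute nothing there, and every other quadratic relation
      -- gives zero or a different squarefree quartic.
      have h0 := congrArg (fun x => coeff (setExp a.2.2.1) (relForm a.1
        (a.2.1.1.orderEmbOfFin a.2.1.2 0) (a.2.1.1.orderEmbOfFin a.2.1.2 1) x)) hc
      simp only [relForm_add, relForm_sum, relForm_smul, coeff_add] at h0
      rw [coeff_eq_zero_of_mem_squareIdeal (Ideal.sum_mem _ fun x _ =>
        Ideal.mul_mem_left _ _ (relForm_mem_squareIdeal a.1 hil (hmem x))), zero_add,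
        coeff_sum, Finset.sum_eq_single b] at h0
      · rw [← ha, relForm_quadraticRel, if_pos ⟨rfl, rfl⟩, coeff_mul_of_isHomogeneous
          (isHomogeneous_monomial _ rfl) le_rfl, coeff_zero_rowSubst, coeff_monomial, if_pos rfl,
          mul_one] at h0
        rw [h0]
        simp [relForm]
      · intro b' _ hb'
        rw [relForm_quadraticRel]
        split_ifs with h
        · rw [coeff_mul_of_isHomogeneous (isHomogeneous_monomial _ rfl)
            (by rw [degree_setExp, degree_setExp, a.2.2.2, (e b').2.2.2]), coeff_monomial,
            if_neg, mul_zero]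
          intro h'
          refine hb' (e.injective ?_)
          rw [← ha]
          exact Prod.ext h.1 (Prod.ext h.2 (Subtype.ext (setExp_injective h')))
        · simp
      · simp
      · intro j
        rw [setExp_apply]
        split_ifs <;> simp

end PermanentRelations

/-! ### Counting standard monomials and the dimension of the space of linear relations. -/

section Dimension

theorem finrank_span_monomial {k σ : Type*} [Field k] (A : Set (σ →₀ ℕ)) [Finite A] :
    Module.finrank k (Submodule.span k ((fun m => (monomial m 1 : MvPolynomial σ k)) '' A))
      = Nat.card A := by
  have := Fintype.ofFinite A
  have hli := ((basisMonomials σ k).linearIndependent.comp _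
    (Subtype.val_injective (p := fun m => m ∈ A)))
  have := finrank_span_eq_card hli
  rw [coe_basisMonomials, Set.range_comp, Subtype.range_coe] at this
  rw [Nat.card_eq_fintype_card]
  exact this

theorem homogeneousSubmodule_eq_span {k σ : Type*} [Field k] (d : ℕ) :
    homogeneousSubmodule σ k d = Submodule.span k
      ((fun m => (monomial m 1 : MvPolynomial σ k)) '' {m : σ →₀ ℕ | m.degree = d}) := by
  refine le_antisymm (fun f hf => ?_) (Submodule.span_le.2 ?_)
  · rw [f.as_sum]
    refine Submodule.sum_mem _ fun m hm => ?_
    rw [← mul_one (coeff m f), ← smul_eq_mul, ← smul_monomial]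
    refine Submodule.smul_mem _ _ (Submodule.subset_span ⟨m, ?_, rfl⟩)
    by_contra h
    exact mem_support_iff.1 hm (IsHomogeneous.coeff_eq_zero hf h)
  · rintro _ ⟨m, hm, rfl⟩
    exact isHomogeneous_monomial _ hm

theorem setOf_degree_eq {σ : Type*} [Fintype σ] [DecidableEq σ] (d : ℕ) :
    {m : σ →₀ ℕ | m.degree = d} = ↑(Finset.univ.finsuppAntidiag d : Finset (σ →₀ ℕ)) := by
  ext m
  simp [Finset.mem_finsuppAntidiag, Finsupp.degree_eq_sum]

theorem finite_degree_eq {σ : Type*} [Finite σ] (d : ℕ) :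
    {m : σ →₀ ℕ | m.degree = d}.Finite := by
  classical
  have := Fintype.ofFinite σ
  rw [setOf_degree_eq]
  exact Finset.finite_toSet _

theorem finrank_homogeneousSubmodule {k σ : Type*} [Field k] [Fintype σ] (d : ℕ) :
    Module.finrank k (homogeneousSubmodule σ k d) = (Fintype.card σ + d - 1).choose d := by
  classical
  have := (finite_degree_eq (σ := σ) d).to_subtype
  rw [homogeneousSubmodule_eq_span, finrank_span_monomial, setOf_degree_eq, Nat.card_coe_set_eq,
    Set.ncard_coe_finset, Finset.card_finsuppAntidiag_nat_eq_choose, Finset.card_univ]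

instance {k σ : Type*} [Field k] [Finite σ] (d : ℕ) :
    FiniteDimensional k (homogeneousSubmodule σ k d) := by
  rw [homogeneousSubmodule_eq_span]
  exact FiniteDimensional.span_of_finite k ((finite_degree_eq d).image _)

variable {n : ℕ}

theorem sum_orderEmbOfFin {d : ℕ} {t : Finset (Fin n)} (ht : t.card = d) (i : Fin n) :
    ∑ p, (if t.orderEmbOfFin ht p = i then 1 else 0) = if i ∈ t then 1 else 0 := by
  have : ∑ j ∈ t, (if j = i then 1 else 0) = if i ∈ t then 1 else 0 := by simp
  rw [← this]
  conv_rhs => rw [← Finset.map_orderEmbOfFin_univ t ht, Finset.sum_map]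
  rfl

/-- The exponent of the antidiagonal monomial with a given set of rows and of columns. -/
def antidiagExp {d : ℕ}
    (a : {s : Finset (Fin n) // s.card = d} × {t : Finset (Fin n) // t.card = d}) :
    Fin n × Fin n →₀ ℕ :=
  ∑ p : Fin d, Finsupp.single (a.1.1.orderEmbOfFin a.1.2 p, a.2.1.orderEmbOfFin a.2.2 p.rev) 1

section

variable {d : ℕ} (a : {s : Finset (Fin n) // s.card = d} × {t : Finset (Fin n) // t.card = d})

theorem antidiagExp_apply (i j : Fin n) : antidiagExp a (i, j) =
    ∑ p, if a.1.1.orderEmbOfFin a.1.2 p = i ∧ a.2.1.orderEmbOfFin a.2.2 p.rev = j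
      then 1 else 0 := by
  classical
  simp [antidiagExp, Finsupp.finsetSum_apply, Finsupp.single_apply]

theorem sum_row_antidiagExp (i : Fin n) :
    ∑ j, antidiagExp a (i, j) = if i ∈ a.1.1 then 1 else 0 := by
  simp only [antidiagExp_apply]
  rw [Finset.sum_comm, ← sum_orderEmbOfFin a.1.2]
  refine Finset.sum_congr rfl fun p _ => ?_
  split_ifs with h <;> simp [h]

theorem sum_col_antidiagExp (j : Fin n) :
    ∑ i, antidiagExp a (i, j) = if j ∈ a.2.1 then 1 else 0 := by
  simp only [antidiagExp_apply]
  rw [Finset.sum_comm, ← sum_orderEmbOfFin a.2.2, ← Equiv.sum_comp Fin.revPerm]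
  refine Finset.sum_congr rfl fun p _ => ?_
  simp only [Fin.revPerm_apply]
  split_ifs with h <;> simp [h]

theorem degree_antidiagExp : (antidiagExp a).degree = d := by
  simp [antidiagExp, Finsupp.degree_single]

theorem isStandard_antidiagExp : IsStandard leadExp (antidiagExp a) := by
  intro q hq
  have hex : ∀ u, antidiagExp a u ≠ 0 → ∃ p,
      (a.1.1.orderEmbOfFin a.1.2 p, a.2.1.orderEmbOfFin a.2.2 p.rev) = u := by
    rintro ⟨i, j⟩ hu
    rw [antidiagExp_apply] at hu
    obtain ⟨p, -, hp⟩ := Finset.exists_ne_zero_of_sum_ne_zero hu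
    exact ⟨p, by simpa using hp⟩
  have h1 := hq (q.1.1.1, q.2.1.1)
  have h2 := hq (q.1.1.2, q.2.1.2)
  simp only [leadExp, Finsupp.add_apply, Finsupp.single_eq_same] at h1 h2
  obtain ⟨p, hp⟩ := hex (q.1.1.1, q.2.1.1) (by omega)
  obtain ⟨p', hp'⟩ := hex (q.1.1.2, q.2.1.2) (by omega)
  simp only [Prod.mk.injEq] at hp hp'
  have e1 := q.1.2
  have e2 := q.2.2
  rw [← hp.1, ← hp'.1, OrderEmbedding.le_iff_le] at e1
  rw [← hp.2, ← hp'.2, OrderEmbedding.le_iff_le, Fin.rev_le_rev] at e2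
  obtain rfl := le_antisymm e1 e2
  rw [← hp.1, ← hp.2, ← hp'.1, ← hp'.2, Finsupp.single_eq_same] at h1
  have h3 := sum_row_antidiagExp a (a.1.1.orderEmbOfFin a.1.2 p)
  have h4 := Finset.single_le_sum (f := fun j => antidiagExp a (a.1.1.orderEmbOfFin a.1.2 p, j))
    (fun _ _ => Nat.zero_le _) (Finset.mem_univ (a.2.1.orderEmbOfFin a.2.2 p.rev))
  split_ifs at h3 <;> omega

theorem antidiagExp_injective : Function.Injective (antidiagExp (n := n) (d := d)) := by
  intro a a' h
  refine Prod.ext (Subtype.ext ?_) (Subtype.ext ?_)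
  · ext i
    have e1 := sum_row_antidiagExp a i
    have e2 := sum_row_antidiagExp a' i
    rw [h, e2] at e1
    split_ifs at e1 <;> simp_all
  · ext i
    have e1 := sum_col_antidiagExp a i
    have e2 := sum_col_antidiagExp a' i
    rw [h, e2] at e1
    split_ifs at e1 <;> simp_all

end

/-- Row and column sums are at most 1, so they are the indicators of the occupied rows and columns;
the antidiagonal monomial on these sets has the same sums, and `IsStandard.ext` applies. -/
theorem IsStandard.exists_antidiagExp {m : Fin n × Fin n →₀ ℕ} (hm : IsStandard leadExp m) :
    ∃ a : {s : Finset (Fin n) // s.card = m.degree} × {t : Finset (Fin n) // t.card = m.degree},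
      antidiagExp a = m := by
  classical
  obtain ⟨s, hs⟩ := hm.exists_le_permExp
  have hrow : ∀ i, ∑ j, m (i, j) ≤ 1 := fun i =>
    (Finset.sum_le_sum fun j _ => hs (i, j)).trans (sum_row_permExp s i).le
  have hcol : ∀ j, ∑ i, m (i, j) ≤ 1 := fun j =>
    (Finset.sum_le_sum fun i _ => hs (i, j)).trans (sum_col_permExp s j).le
  have hrow' : ∀ i, ∑ j, m (i, j) = if ∑ j, m (i, j) ≠ 0 then 1 else 0 := fun i => by
    have := hrow i
    split_ifs <;> omega
  have hcol' : ∀ j, ∑ i, m (i, j) = if ∑ i, m (i, j) ≠ 0 then 1 else 0 := fun j => by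
    have := hcol j
    split_ifs <;> omega
  have hA : (Finset.univ.filter fun i => ∑ j, m (i, j) ≠ 0).card = m.degree := by
    rw [Finset.card_filter, Finsupp.degree_eq_sum, Fintype.sum_prod_type]
    exact Finset.sum_congr rfl fun i _ => (hrow' i).symm
  have hB : (Finset.univ.filter fun j => ∑ i, m (i, j) ≠ 0).card = m.degree := by
    rw [Finset.card_filter, Finsupp.degree_eq_sum, Fintype.sum_prod_type_right]
    exact Finset.sum_congr rfl fun i _ => (hcol' i).symm
  refine ⟨(⟨_, hA⟩, ⟨_, hB⟩), (isStandard_antidiagExp _).ext hm (fun i => ?_) fun j => ?_⟩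
  · rw [sum_row_antidiagExp]
    simpa using (hrow' i).symm
  · rw [sum_col_antidiagExp]
    simpa using (hcol' j).symm

theorem standardSpan_eq_span (k : Type*) [Field k] (d : ℕ) :
    standardSpan k (leadExp (n := n)) {d} = Submodule.span k
      ((fun m => (monomial m 1 : MvPolynomial (Fin n × Fin n) k)) ''
        Set.range (antidiagExp (n := n) (d := d))) := by
  rw [standardSpan]
  congr 1
  ext f
  constructor
  · rintro ⟨m, h1, h2, rfl⟩
    obtain rfl : m.degree = d := h2
    obtain ⟨a, ha⟩ := h1.exists_antidiagExp
    exact ⟨m, ⟨a, ha⟩, rfl⟩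
  · rintro ⟨_, ⟨a, rfl⟩, rfl⟩
    exact ⟨_, isStandard_antidiagExp a, degree_antidiagExp a, rfl⟩

theorem finrank_standardSpan (k : Type*) [Field k] (d : ℕ) :
    Module.finrank k (standardSpan k (leadExp (n := n)) {d}) = n.choose d * n.choose d := by
  rw [standardSpan_eq_span, finrank_span_monomial,
    Nat.card_congr (Equiv.ofInjective _ antidiagExp_injective).symm, Nat.card_prod,
    Nat.card_eq_fintype_card, Fintype.card_finset_len, Fintype.card_fin]

theorem card_quadricIndex : Fintype.card (QuadricIndex n) = (n + 1).choose 2 * (n + 1).choose 2 := by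
  have h : Fintype.card {r : Fin n × Fin n // r.1 ≤ r.2} = (n + 1).choose 2 := by
    rw [← Fintype.card_congr Sym2.sortEquiv, Sym2.card, Fintype.card_fin]
  rw [Fintype.card_prod, h]

variable {k : Type*} [Field k]

/-- The evaluation of tuples of linear forms on the quadrics. -/
def evalLinear (ε : k) (n : ℕ) : (QuadricIndex n → homogeneousSubmodule (Fin n × Fin n) k 1) →ₗ[k]
    MvPolynomial (Fin n × Fin n) k :=
  evalRel (shafieiQuadric ε) ∘ₗ
    ((homogeneousSubmodule (Fin n × Fin n) k 1).subtype.compLeft (QuadricIndex n))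

theorem map_ker_evalLinear (ε : k) : (LinearMap.ker (evalLinear ε n)).map
    ((homogeneousSubmodule (Fin n × Fin n) k 1).subtype.compLeft (QuadricIndex n))
      = linearRels ε n := by
  ext c
  constructor
  · rintro ⟨c, hc, rfl⟩
    exact ⟨fun p => (c p).2, hc⟩
  · rintro ⟨h1, h2⟩
    exact ⟨fun p => ⟨c p, h1 p⟩, h2, rfl⟩

/-- Division in degree 3: the quotients of a cubic by quadrics are linear forms, and the remainder
is standard. -/
theorem range_evalLinear_sup {ε : k} {I : Ideal (MvPolynomial (Fin n × Fin n) k)}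
    (hB : IsQuadraticBasis cellWeight leadExp (shafieiQuadric (n := n) ε) I) :
    LinearMap.range (evalLinear ε n) ⊔ standardSpan k leadExp {3}
      = homogeneousSubmodule (Fin n × Fin n) k 3 := by
  refine le_antisymm (sup_le ?_ ?_) fun f hf => ?_
  · rintro _ ⟨c, rfl⟩
    rw [evalLinear, LinearMap.comp_apply, evalRel_apply]
    exact Submodule.sum_mem _ fun p _ => IsHomogeneous.mul (c p).2 (isHomogeneous_shafieiQuadric ε p)
  · refine Submodule.span_le.2 ?_
    rintro _ ⟨m, -, hm, rfl⟩
    exact isHomogeneous_monomial _ hm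
  · have hf' : f ∈ monosBelow k cellWeight {3}
        (f.support.sup (Finsupp.weight cellWeight) + 1) := by
      refine mem_monosBelow_of_coeff fun m hm => ⟨?_, Nat.lt_succ_of_le
        (Finset.le_sup (f := Finsupp.weight cellWeight) hm)⟩
      by_contra h
      exact mem_support_iff.1 hm (IsHomogeneous.coeff_eq_zero hf h)
    obtain ⟨_, ⟨c, hc, rfl⟩, s, hs, rfl⟩ := Submodule.mem_sup.1 (hB.monosBelow_le _ _ hf')
    refine Submodule.add_mem_sup ?_ hs
    have hc1 : c ∈ relsBelow k cellWeight leadExp {1} _ := relsBelow_mono _ _ (by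
      intro e he
      simp only [Set.mem_ofPred_eq, Set.mem_singleton_iff] at he ⊢
      omega) le_rfl hc
    exact ⟨fun p => ⟨c p, IsQuadraticBasis.hasCoeffDegree_of_mem_relsBelow hc1 p⟩, rfl⟩

theorem range_evalLinear_inf {ε : k} {I : Ideal (MvPolynomial (Fin n × Fin n) k)}
    (hB : IsQuadraticBasis cellWeight leadExp (shafieiQuadric (n := n) ε) I) :
    LinearMap.range (evalLinear ε n) ⊓ standardSpan k leadExp {3} = ⊥ := by
  refine (Submodule.eq_bot_iff _).2 ?_
  rintro _ ⟨⟨c, rfl⟩, hs⟩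
  exact hB.eq_zero _ (hB.evalRel_mem _) (standardSpan_mono _ (Set.subset_univ _) hs)

theorem two_mul_choose_two (m : ℕ) : 2 * (m.choose 2 : ℤ) = m * (m - 1) := by
  induction m with
  | zero => simp
  | succ m ih =>
    rw [Nat.choose_succ_succ' m 1, Nat.choose_one_right]
    push_cast
    linear_combination ih

theorem six_mul_choose_three (m : ℕ) : 6 * (m.choose 3 : ℤ) = m * (m - 1) * (m - 2) := by
  induction m with
  | zero => simp
  | succ m ih =>
    rw [Nat.choose_succ_succ' m 2]
    push_cast
    linear_combination ih + 3 * two_mul_choose_two m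

instance (ε : k) : FiniteDimensional k (linearRels ε n) := by
  rw [← map_ker_evalLinear]
  infer_instance

/-- Rank-nullity for `evalLinear`, whose image is complementary to the standard cubics. The
dimension is `n^2 * ((n+1) choose 2)^2 - ((n^2+2) choose 3) + (n choose 3)^2`. -/
theorem finrank_linearRels {ε : k} {I : Ideal (MvPolynomial (Fin n × Fin n) k)}
    (hB : IsQuadraticBasis cellWeight leadExp (shafieiQuadric (n := n) ε) I) :
    Module.finrank k (linearRels ε n) = 4 * (n + 1).choose 3 * (n + 2).choose 3 := by
  have hinj : Function.Injective
      ((homogeneousSubmodule (Fin n × Fin n) k 1).subtype.compLeft (QuadricIndex n)) := by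
    intro c c' h
    ext p : 2
    exact congrFun h p
  have h1 : Module.finrank k (linearRels ε n)
      = Module.finrank k (LinearMap.ker (evalLinear ε n)) := by
    rw [← map_ker_evalLinear]
    exact (Submodule.equivMapOfInjective _ hinj _).finrank_eq.symm
  have h2 := LinearMap.finrank_range_add_finrank_ker (evalLinear ε n)
  rw [Module.finrank_pi_fintype, Finset.sum_const, Finset.card_univ, card_quadricIndex,
    finrank_homogeneousSubmodule, ← h1, Fintype.card_prod, Fintype.card_fin, smul_eq_mul] at h2
  have : FiniteDimensional k (standardSpan k (leadExp (n := n)) {3}) := by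
    rw [standardSpan_eq_span]
    exact FiniteDimensional.span_of_finite k ((Set.finite_range _).image _)
  have h3 := Submodule.finrank_sup_add_finrank_inf_eq (LinearMap.range (evalLinear ε n))
    (standardSpan k (leadExp (n := n)) {3})
  rw [range_evalLinear_sup hB, range_evalLinear_inf hB, finrank_bot, finrank_homogeneousSubmodule,
    finrank_standardSpan, Fintype.card_prod, Fintype.card_fin] at h3
  rw [Nat.add_sub_cancel, Nat.choose_one_right] at h2
  rw [add_zero, show n * n + 3 - 1 = n * n + 2 from rfl] at h3
  have e2 := two_mul_choose_two (n + 1)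
  have e3 := six_mul_choose_three n
  have e4 := six_mul_choose_three (n + 1)
  have e5 := six_mul_choose_three (n + 2)
  have e6 := six_mul_choose_three (n * n + 2)
  zify at h2 h3 ⊢
  push_cast at e2 e4 e5 e6
  -- The factor 36 clears the denominators of products of two binomial coefficients with lower index
  -- 2 or 3.
  refine mul_left_cancel₀ (show (36 : ℤ) ≠ 0 by norm_num) ?_
  linear_combination 36 * h2 + 36 * h3
    + 9 * (n : ℤ) ^ 2 * (2 * ((n + 1).choose 2 : ℤ) + (n + 1) * (n + 1 - 1)) * e2
    + (6 * (n.choose 3 : ℤ) + n * (n - 1) * (n - 2)) * e3 - 6 * e6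
    - 4 * (6 * ((n + 2).choose 3 : ℤ)) * e4 - 4 * ((n + 1) * (n + 1 - 1) * (n + 1 - 2)) * e5

end Dimension

/-! ### Bases of linear relations with the required index types, and the theorem. -/

section Counting

variable {k : Type*} [Field k] {n : ℕ}

theorem exists_basis_linearRels {ε : k} {I : Ideal (MvPolynomial (Fin n × Fin n) k)}
    (hB : IsQuadraticBasis cellWeight leadExp (shafieiQuadric (n := n) ε) I) :
    ∃ l : Fin (4 * (n + 1).choose 3 * (n + 2).choose 3) →
      QuadricIndex n → MvPolynomial (Fin n × Fin n) k,
      LinearIndependent k l ∧ Submodule.span k (Set.range l) = linearRels ε n := by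
  let b := Module.finBasisOfFinrankEq k (linearRels ε n) (finrank_linearRels hB)
  refine ⟨(linearRels ε n).subtype ∘ b, b.linearIndependent.map' _ (Submodule.ker_subtype _), ?_⟩
  rw [Set.range_comp, ← Submodule.map_span, b.span_eq, Submodule.map_top, Submodule.range_subtype]

theorem card_koszulIndex : Fintype.card (KoszulIndex n) = 2 * n.choose 2 * n.choose 4 := by
  simp [Fintype.card_prod, mul_assoc]

theorem hasCoeffDegree_of_span_eq {κ : Type*} {ε : k}
    {l : κ → QuadricIndex n → MvPolynomial (Fin n × Fin n) k}
    (hl : Submodule.span k (Set.range l) = linearRels ε n) (a : κ) : HasCoeffDegree 1 (l a) := by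
  have : l a ∈ linearRels ε n := hl ▸ Submodule.subset_span ⟨a, rfl⟩
  exact this.1

end Counting

end

theorem theorem1p2 (k : Type*) [Field k] (n : ℕ) (hn : 1 ≤ n) :
    (ringChar k ≠ 2 →
      IsMinimalGeneratingFamily (apolarIdeal (detPoly k n)) (detQuadric k n) ∧
      ∃ l : Fin (4 * (n + 1).choose 3 * (n + 2).choose 3) →
          (QuadricIndex n → MvPolynomial (Fin n × Fin n) k),
        (∀ a, HasCoeffDegree 1 (l a)) ∧
        IsMinimalGeneratingFamily (relationModule (detQuadric k n)) l) ∧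
    (IsMinimalGeneratingFamily (apolarIdeal (permPoly k n)) (permQuadric k n) ∧
      ∃ (l : Fin (4 * (n + 1).choose 3 * (n + 2).choose 3) →
          (QuadricIndex n → MvPolynomial (Fin n × Fin n) k))
        (q : Fin (2 * n.choose 2 * n.choose 4) →
          (QuadricIndex n → MvPolynomial (Fin n × Fin n) k)),
        (∀ a, HasCoeffDegree 1 (l a)) ∧ (∀ b, HasCoeffDegree 2 (q b)) ∧
        IsMinimalGeneratingFamily (relationModule (permQuadric k n)) (Sum.elim l q)) := by
  refine ⟨fun hchar => ⟨isMinimalGeneratingFamily_shafieiQuadric isQuadraticBasis_detQuadric, ?_⟩,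
    isMinimalGeneratingFamily_shafieiQuadric isQuadraticBasis_permQuadric, ?_⟩
  · obtain ⟨l, hl, hspan⟩ := exists_basis_linearRels (k := k) (n := n) isQuadraticBasis_detQuadric
    have hdeg := hasCoeffDegree_of_span_eq hspan
    -- A `k`-basis of the linear relations has the right size and spans the same `S`-module as all
    -- linear relations, which is the whole relation module because 2 is invertible.
    refine ⟨l, hdeg, isMinimalGeneratingFamily_of_linearIndependent hdeg hl ?_⟩
    rw [detQuadric, ← relationModule_detQuadric (Ring.two_ne_zero hchar), ← hspan]
    exact (Submodule.span_span_of_tower k _ _).symm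
  · obtain ⟨l, hl, hspan⟩ := exists_basis_linearRels (k := k) (n := n) isQuadraticBasis_permQuadric
    let e : Fin (2 * n.choose 2 * n.choose 4) ≃ KoszulIndex n :=
      (Fintype.equivFinOfCardEq card_koszulIndex).symm
    exact ⟨l, quadraticRel k n ∘ e, hasCoeffDegree_of_span_eq hspan,
      fun b => hasCoeffDegree_koszulRel _ _ _ _ _,
      isMinimalGeneratingFamily_permQuadric hl hspan e⟩
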